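/- There are absolute constants $C,c_0,c_1>0$ such that the following holds for all integers $1\le d\le n$ and all $\delta\in(0,1/2)$. **Model.** Let $\eta_1,\dots,\eta_n\in\{-1,1\}$ be a homogeneous binary symmetric Markov chain with flip probability $\delta$: $\eta_1$ is a Rademacher variable and, given $\eta_1,\dots,\eta_i$, one has $\eta_{i+1}=-\eta_i$ with probability $\delta$ and $\eta_{i+1}=\eta_i$ with probability $1-\delta$. Let $\xi_1,\dots,\xi_n$ be i.i.d. random vectors in $\mathbf R^d$, independent of $\eta$, isotropic ($\mathbf E\langle v,\xi_i\rangle^2=\|v\|^2$ for all $v$) and $1$-sub-Gaussian ($\mathbf E\, e^{\langle v,\xi_i\rangle}\le e^{\|v\|^2/2}$ for all $v$). For $\theta\in\mathbf R^d$ the observations are $Y_i=\eta_i\theta+\xi_i$, $i=1,\dots,n$. **Estimator.** For an integer $1\le\ell\le n$ put $k=\lfloor n/\ell\rfloor$ (so $n=k\ell$ when $\ell$ divides $n$), and let $I_i=\{(i-1)k+1,\dots,ik\}$, $i=1,\dots,\ell$; the at most $\ell-1$ observations left over are not used. Put $\tilde Y_i=\frac1k\sum_{j\in I_i}Y_j$,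 $\bar\eta_i=\frac1k\sum_{j\in I_i}\eta_j$, $\bar\eta=(\bar\eta_1,\dots,\bar\eta_\ell)$, $\hat\Sigma=\frac1\ell\sum_{i=1}^\ell\tilde Y_i\tilde Y_i^{\top}$, and $$\hat\theta(\ell)=\sqrt{\frac{\ell}{\mathbf E\|\bar\eta\|^2}\Big(\lambda_{\max}(\hat\Sigma)-\frac1k\Big)_+}\;v_{\max}(\hat\Sigma),$$ where $\lambda_{\max}$ is the top eigenvalue and $v_{\max}$ any choice of a corresponding unit eigenvector. Let $$\ell^*=d\vee\lceil n(\delta\vee\|\theta\|^2)\rceil\wedge n,\qquad \ell(a,b)=\min\{\|a-b\|,\|a+b\|\}.$$ **Claim.** For every $\theta\in\mathbf R^d$, with probability at least $1-c_1e^{-c_0d}$, $$\ell^2(\hat\theta(\ell^*),\theta)\le C\cdot\begin{cases}\sqrt{\frac{\delta d}{n}}+\frac dn, & \|\theta\|^2\le\sqrt{\frac{\delta d}{n}}\vee\frac dn,\\[4pt] \frac{\delta d/n}{\|\theta\|^2}, & \frac dn\le\delta\ \text{ and }\ \sqrt{\frac{\delta d}{n}}\vee\frac dn\le\|\theta\|^2\le\delta\vee\frac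 dn,\\[4pt] \frac dn, & \delta\vee\frac dn\le\|\theta\|^2.\end{cases}$$ Moreover, for every $\theta\in\mathbf R^d$, with probability at least $1-c_1e^{-c_0d}$, $\ell^2(\hat\theta(\ell^*),\theta)\le C\big(\sqrt{\delta d/n}+d/n\big)$. Consequently $\hat\theta(\ell^*)$ is locally and globally minimax optimal in the following sense. Let $\phi(\theta)$ be the three-regime rate above (a boundary value of $\|\theta\|^2$ being put in the first regime that contains it). Then $$\sup_{\theta}\mathbf P\big(\ell^2(\hat\theta(\ell^*),\theta)\ge C\phi(\theta)\big)\le c_1e^{-c_0d},\qquad \sup_{\theta}\mathbf P\Big(\ell^2(\hat\theta(\ell^*),\theta)\ge C\Big(\sqrt{\tfrac{\delta d}{n}}+\tfrac dn\Big)\Big)\le c_1e^{-c_0d}.$$ -/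

import Mathlib

open MeasureTheory ProbabilityTheory

noncomputable section

namespace MarkovMixture

/-- `η 0, …, η (n-1)` is a homogeneous binary symmetric Markov chain with flip probability `δ`:
the first label is Rademacher and, given any past path, the next label is the opposite of the
current one with probability `δ` and equal to it with probability `1 - δ`. -/
structure IsSymmetricChain {Ω : Type*} [MeasurableSpace Ω] (μ : Measure Ω) (δ : ℝ) {n : ℕ}
    (η : Fin n → Ω → ℝ) : Prop where
  measurable : ∀ i, Measurable (η i)
  label : ∀ i, ∀ᵐ ω ∂μ, η i ω = 1 ∨ η i ω = -1
  init : ∀ i : Fin n, (i : ℕ) = 0 →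
    μ.real {ω | η i ω = 1} = 1 / 2 ∧ μ.real {ω | η i ω = -1} = 1 / 2
  flip : ∀ i j : Fin n, (j : ℕ) = i + 1 → ∀ s : Fin n → ℝ,
    μ.real {ω | (∀ m ≤ i, η m ω = s m) ∧ η j ω = -η i ω}
      = δ * μ.real {ω | ∀ m ≤ i, η m ω = s m}
  stay : ∀ i j : Fin n, (j : ℕ) = i + 1 → ∀ s : Fin n → ℝ,
    μ.real {ω | (∀ m ≤ i, η m ω = s m) ∧ η j ω = η i ω}
      = (1 - δ) * μ.real {ω | ∀ m ≤ i, η m ω = s m}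

/-- `ξ 0, …, ξ (n-1)` are i.i.d. isotropic `1`-sub-Gaussian random vectors in `ℝ^d`. -/
structure IsSubGaussianNoise {Ω : Type*} [MeasurableSpace Ω] (μ : Measure Ω) {n d : ℕ}
    (ξ : Fin n → Ω → EuclideanSpace ℝ (Fin d)) : Prop where
  measurable : ∀ i, Measurable (ξ i)
  indep : iIndepFun ξ μ
  identDistrib : ∀ i j, IdentDistrib (ξ i) (ξ j) μ μ
  isotropic : ∀ i, ∀ v : EuclideanSpace ℝ (Fin d),
    ∫ ω, (inner ℝ v (ξ i ω)) ^ 2 ∂μ = ‖v‖ ^ 2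
  subGaussian : ∀ i, ∀ v : EuclideanSpace ℝ (Fin d),
    Integrable (fun ω => Real.exp (inner ℝ v (ξ i ω))) μ ∧
      ∫ ω, Real.exp (inner ℝ v (ξ i ω)) ∂μ ≤ Real.exp (‖v‖ ^ 2 / 2)

/-- The hidden Markov mixture model: a symmetric chain of labels and an independent noise. -/
structure IsModel {Ω : Type*} [MeasurableSpace Ω] (μ : Measure Ω) (δ : ℝ) {n d : ℕ}
    (η : Fin n → Ω → ℝ) (ξ : Fin n → Ω → EuclideanSpace ℝ (Fin d)) : Prop where
  chain : IsSymmetricChain μ δ η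
  noise : IsSubGaussianNoise μ ξ
  indep : IndepFun (fun ω i => η i ω) (fun ω i => ξ i ω) μ

/-- The observations `Y i = η i • θ + ξ i`. -/
def obs {Ω : Type*} {n d : ℕ} (η : Fin n → Ω → ℝ) (ξ : Fin n → Ω → EuclideanSpace ℝ (Fin d))
    (θ : EuclideanSpace ℝ (Fin d)) (ω : Ω) (i : Fin n) : EuclideanSpace ℝ (Fin d) :=
  η i ω • θ + ξ i ω

/-- The length `k` of a bucket; `k = n / ℓ` when `ℓ` divides `n`. -/
def bucketLength (n l : ℕ) : ℕ := n / l

/-- The `i`-th bucket `{i k, …, (i + 1) k - 1}`. If `ℓ` does not divide `n`, the last `n - k ℓ`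
observations belong to no bucket. -/
def bucket (n l : ℕ) (i : Fin l) : Finset (Fin n) :=
  Finset.univ.filter fun j =>
    (i : ℕ) * bucketLength n l ≤ (j : ℕ) ∧ (j : ℕ) < ((i : ℕ) + 1) * bucketLength n l

/-- The mean over the `i`-th bucket. -/
def bucketMean {V : Type*} [AddCommGroup V] [Module ℝ V] {n : ℕ} (l : ℕ) (x : Fin n → V)
    (i : Fin l) : V :=
  (bucketLength n l : ℝ)⁻¹ • ∑ j ∈ bucket n l i, x j

/-- The number `𝐄 ‖η̄‖²`, where `η̄ = (η̄_1, …, η̄_ℓ)` is the vector of bucket means of labels. -/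
def expSqNorm {Ω : Type*} [MeasurableSpace Ω] (μ : Measure Ω) {n : ℕ} (l : ℕ)
    (η : Fin n → Ω → ℝ) : ℝ :=
  ∫ ω, ∑ i : Fin l, (bucketMean l (fun j => η j ω) i) ^ 2 ∂μ

/-- The `d × ℓ` matrix whose columns are the bucket means of the data `Y`. -/
def bucketMatrix {n d : ℕ} (l : ℕ) (Y : Fin n → EuclideanSpace ℝ (Fin d)) :
    Matrix (Fin d) (Fin l) ℝ :=
  Matrix.of fun a i => bucketMean l Y i a

/-- `Σ̂ = ℓ⁻¹ Ỹ Ỹᵀ`. -/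
def sampleCov {n d : ℕ} (l : ℕ) (Y : Fin n → EuclideanSpace ℝ (Fin d)) :
    Matrix (Fin d) (Fin d) ℝ :=
  (l : ℝ)⁻¹ • (bucketMatrix l Y * (bucketMatrix l Y).transpose)

/-- The top eigenvalue of a symmetric matrix. -/
def lambdaMax {d : ℕ} (A : Matrix (Fin d) (Fin d) ℝ) : ℝ := sSup (spectrum ℝ A)

/-- `vmax` picks, for every symmetric matrix, a unit eigenvector for its top eigenvalue. -/
def IsTopEigenvectorMap {d : ℕ}
    (vmax : Matrix (Fin d) (Fin d) ℝ → EuclideanSpace ℝ (Fin d)) : Prop :=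
  ∀ A : Matrix (Fin d) (Fin d) ℝ, A.IsSymm →
    ‖vmax A‖ = 1 ∧ A.mulVec (vmax A).ofLp = lambdaMax A • (vmax A).ofLp

/-- The spectral estimator with `ℓ` buckets computed from the data `Y`, where the number `E`
stands for `𝐄 ‖η̄‖²`. -/
def thetaHat {n d : ℕ} (vmax : Matrix (Fin d) (Fin d) ℝ → EuclideanSpace ℝ (Fin d))
    (l : ℕ) (E : ℝ) (Y : Fin n → EuclideanSpace ℝ (Fin d)) : EuclideanSpace ℝ (Fin d) :=
  Real.sqrt ((l : ℝ) / E * max (lambdaMax (sampleCov l Y) - 1 / (bucketLength n l : ℝ)) 0) •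
    vmax (sampleCov l Y)

/-- The number of buckets `ℓ* = d ∨ ⌈n (δ ∨ ‖θ‖²)⌉ ∧ n`. -/
def ellStar (n : ℕ) {d : ℕ} (δ : ℝ) (θ : EuclideanSpace ℝ (Fin d)) : ℕ :=
  max d (min ⌈(n : ℝ) * max δ (‖θ‖ ^ 2)⌉₊ n)

/-- The estimator `θ̂(ℓ*)` evaluated on the observations generated by `θ`. -/
def oracle {Ω : Type*} [MeasurableSpace Ω] (μ : Measure Ω) (δ : ℝ) {n d : ℕ}
    (η : Fin n → Ω → ℝ) (ξ : Fin n → Ω → EuclideanSpace ℝ (Fin d))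
    (vmax : Matrix (Fin d) (Fin d) ℝ → EuclideanSpace ℝ (Fin d))
    (θ : EuclideanSpace ℝ (Fin d)) (ω : Ω) : EuclideanSpace ℝ (Fin d) :=
  thetaHat vmax (ellStar n δ θ) (expSqNorm μ (ellStar n δ θ) η) (obs η ξ θ ω)

/-- The loss `ℓ(a, b) = min (‖a - b‖, ‖a + b‖)`. -/
def loss {d : ℕ} (a b : EuclideanSpace ℝ (Fin d)) : ℝ := min ‖a - b‖ ‖a + b‖

/-- The global rate `√(δ d / n) + d / n`. -/
def globalRate (n d : ℕ) (δ : ℝ) : ℝ := Real.sqrt (δ * d / n) + (d : ℝ) / n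

/-- The three-regime local rate `φ(θ)`; a boundary value of `‖θ‖²` is put in the first regime
that contains it. -/
def localRate (n : ℕ) {d : ℕ} (δ : ℝ) (θ : EuclideanSpace ℝ (Fin d)) : ℝ :=
  if ‖θ‖ ^ 2 ≤ max (Real.sqrt (δ * d / n)) ((d : ℝ) / n) then globalRate n d δ
  else if ‖θ‖ ^ 2 ≤ max δ ((d : ℝ) / n) then (δ * d / n) / ‖θ‖ ^ 2
  else (d : ℝ) / n

/-- Local minimax optimality of `est` with constants `C, c₀, c₁`; `est θ` is the estimator on the
observations generated by `θ`. -/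
def IsLocallyMinimaxOptimal {Ω : Type*} [MeasurableSpace Ω] (μ : Measure Ω) (n : ℕ) {d : ℕ}
    (δ : ℝ) (est : EuclideanSpace ℝ (Fin d) → Ω → EuclideanSpace ℝ (Fin d))
    (C c₀ c₁ : ℝ) : Prop :=
  ⨆ θ : EuclideanSpace ℝ (Fin d), μ {ω | C * localRate n δ θ ≤ loss (est θ ω) θ ^ 2}
    ≤ ENNReal.ofReal (c₁ * Real.exp (-(c₀ * d)))

/-- Global minimax optimality of `est` with constants `C, c₀, c₁`. -/
def IsGloballyMinimaxOptimal {Ω : Type*} [MeasurableSpace Ω] (μ : Measure Ω) (n : ℕ) {d : ℕ}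
    (δ : ℝ) (est : EuclideanSpace ℝ (Fin d) → Ω → EuclideanSpace ℝ (Fin d))
    (C c₀ c₁ : ℝ) : Prop :=
  ⨆ θ : EuclideanSpace ℝ (Fin d), μ {ω | C * globalRate n d δ ≤ loss (est θ ω) θ ^ 2}
    ≤ ENNReal.ofReal (c₁ * Real.exp (-(c₀ * d)))

end MarkovMixture

end

/-! Write A for the mean of the squared bucket label means, a for its expectation `expSqNorm / l`,
and k for the bucket length. By `sampleCov_decomposition`, Σ̂ - I/k is the sum of A θθᵀ, of a cross
term θuᵀ + uθᵀ with u = `crossVec`, and of the centred noise covariance `noiseForm`. After division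
by a, this is θθᵀ up to an operator-norm error of order q = g‖θ‖² + 2‖θ‖U + w, where g, U, w bound
|A - a|, ‖u‖ and the noise deviation.

Rank-one perturbation (`loss_sq_le_of_perturbation`) turns an error e into two bounds: loss² ≤ 3e,
which is right for weak signals, and loss²‖θ‖² ≤ 12e², which is better for strong ones.

Outside an event of probability at most 8e^{-d} three estimates hold. Bernstein's inequality for
squares on a net, in its Gaussian range because ℓ ≥ d, gives w ≲ √(d/ℓ)/k. Conditioning on the
labels makes u a sub-Gaussian sum, so U ≲ √(d/n). Hoeffding's inequality gives g ≤ √(d/ℓ). The last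
one needs independence: the squared bucket means do not see the sign accumulated before the bucket,
so they are functions of the increments inside it, and the increments of the chain are independent
(`iIndepFun_increment`).

The choice ℓ* balances these errors. Since kδ ≤ 1, a bucket has no inner flip with probability
bounded below, so a ≥ e^{-2}. Either k = 1, where the label energy is deterministic, or ℓ* ≥ n‖θ‖²,
which makes g‖θ‖² at most √(d/n)‖θ‖. Up to constants q is then at most ρ, with ρ = √(δd/n) + d/n,
√(δd/n) or √(d/n)‖θ‖ in the three regimes. The first regime uses the bound by ρ, the other two the
bound by ρ²/‖θ‖². -/

noncomputable section

namespace MarkovMixture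

/-! ### Independence of blocks, and nets of the unit ball -/

/-- Functions of pairwise disjoint groups of independent variables are independent. -/
lemma iIndepFun_comp_disjoint {Ω ι κ : Type*} [MeasurableSpace Ω] {μ : Measure Ω}
    [IsProbabilityMeasure μ] {β : Type*} [MeasurableSpace β] {γ : Type*} [MeasurableSpace γ]
    {f : ι → Ω → β} (hf : iIndepFun f μ) (hm : ∀ i, Measurable (f i))
    (S : κ → Finset ι) (hS : Pairwise fun i j => Disjoint (S i) (S j))
    (g : ∀ i, (S i → β) → γ) (hg : ∀ i, Measurable (g i)) :
    iIndepFun (fun i ω => g i fun j => f j ω) μ := by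
  classical
  rw [iIndepFun_iff_measure_inter_preimage_eq_mul]
  intro T B hB
  induction T using Finset.induction_on with
  | empty => simp
  | insert i T hi ih =>
    rw [Finset.prod_insert hi, Finset.set_biInter_insert,
      ← ih fun j hj => hB j (Finset.mem_insert_of_mem hj)]
    have hd : Disjoint (S i) (T.biUnion S) := by
      rw [Finset.disjoint_biUnion_right]
      intro j hj
      exact hS (by rintro rfl; exact hi hj)
    have h := hf.indepFun_finset (S i) (T.biUnion S) hd hm
    rw [indepFun_iff_measure_inter_preimage_eq_mul] at h
    have h1 : MeasurableSet (g i ⁻¹' B i) := hg i (hB i (Finset.mem_insert_self _ _))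
    -- Restriction from the union of the remaining groups to one of them: all remaining events
    -- depend on that union only, which is disjoint from `S i`.
    let r : ∀ j : T, (T.biUnion S → β) → (S j → β) := fun j x a =>
      x ⟨a, Finset.mem_biUnion.2 ⟨j, j.2, a.2⟩⟩
    have hr : ∀ j, Measurable (r j) := fun j => by
      refine measurable_pi_lambda _ fun a => measurable_pi_apply _
    have h2 : MeasurableSet (⋂ j : T, (fun x => g j (r j x)) ⁻¹' B j) :=
      MeasurableSet.iInter fun j =>
        ((hg j).comp (hr j)) (hB j (Finset.mem_insert_of_mem j.2))
    have := h _ _ h1 h2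
    have e1 : (⋂ j ∈ T, (fun ω => g j fun a => f a ω) ⁻¹' B j)
        = (fun ω (a : T.biUnion S) => f a ω) ⁻¹' ⋂ j : T, (fun x => g j (r j x)) ⁻¹' B j := by
      ext ω; simp [r]
    rw [e1]
    exact this

/-- The unit ball of a Euclidean space has a `1/2`-net of cardinality at most `5 ^ d`. -/
lemma exists_half_net (d : ℕ) :
    ∃ s : Finset (EuclideanSpace ℝ (Fin d)), s.card ≤ 5 ^ d ∧ (∀ x ∈ s, ‖x‖ ≤ 1) ∧
      ∀ y : EuclideanSpace ℝ (Fin d), ‖y‖ ≤ 1 → ∃ x ∈ s, ‖y - x‖ ≤ 1 / 2 := by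
  classical
  set E := EuclideanSpace ℝ (Fin d)
  -- A `1/2`-separated set of maximal cardinality is a net. Doubling it gives a 1-separated set in
  -- the ball of radius 2, whence the bound `5 ^ d`.
  let P : ℕ → Prop := fun m => ∃ s : Finset E, s.card = m ∧ (∀ x ∈ s, ‖x‖ ≤ 1) ∧
    ∀ x ∈ s, ∀ y ∈ s, x ≠ y → 1 / 2 ≤ ‖x - y‖
  have hP : ∀ m, P m → m ≤ 5 ^ d := by
    rintro m ⟨s, rfl, hs, hsep⟩
    have := Besicovitch.card_le_of_separated (s.image fun x => (2 : ℝ) • x) ?_ ?_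
    · rw [Finset.card_image_of_injective _ (smul_right_injective E two_ne_zero)] at this
      simpa [E] using this
    · intro c hc
      obtain ⟨x, hx, rfl⟩ := Finset.mem_image.1 hc
      rw [norm_smul]; have := hs x hx; norm_num; linarith
    · intro c hc c' hc' hne
      obtain ⟨x, hx, rfl⟩ := Finset.mem_image.1 hc
      obtain ⟨y, hy, rfl⟩ := Finset.mem_image.1 hc'
      have := hsep x hx y hy (by rintro rfl; exact hne rfl)
      rw [← smul_sub, norm_smul]; norm_num; linarith
  have h0 : P 0 := ⟨∅, by simp, by simp, by simp⟩
  obtain ⟨s, hcard, hs, hsep⟩ : P (Nat.findGreatest P (5 ^ d)) :=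
    Nat.findGreatest_spec (Nat.zero_le _) h0
  refine ⟨s, hcard ▸ Nat.findGreatest_le _, hs, fun y hy => ?_⟩
  by_contra! hfar
  have hys : y ∉ s := fun h => by have := hfar y h; norm_num at this
  have h1 : P (s.card + 1) := by
    refine ⟨insert y s, Finset.card_insert_of_notMem hys, ?_, ?_⟩
    · intro x hx
      rcases Finset.mem_insert.1 hx with rfl | hx
      exacts [hy, hs x hx]
    · intro x hx z hz hne
      rcases Finset.mem_insert.1 hx with rfl | hx <;> rcases Finset.mem_insert.1 hz with rfl | hz
      · exact absurd rfl hne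
      · exact (hfar z hz).le
      · rw [norm_sub_rev]; exact (hfar x (by assumption)).le
      · exact hsep x hx z hz hne
  have := Nat.le_findGreatest (hP _ h1) h1
  omega

/-- A linear functional is controlled by its values on a `1/2`-net of the unit ball. -/
lemma abs_le_two_mul_of_net {d : ℕ} {s : Finset (EuclideanSpace ℝ (Fin d))}
    (hs : ∀ y : EuclideanSpace ℝ (Fin d), ‖y‖ ≤ 1 → ∃ x ∈ s, ‖y - x‖ ≤ 1 / 2)
    (f : EuclideanSpace ℝ (Fin d) →ₗ[ℝ] ℝ) {M : ℝ} (hM : ∀ x ∈ s, |f x| ≤ M)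
    (y : EuclideanSpace ℝ (Fin d)) : |f y| ≤ 2 * M * ‖y‖ := by
  let F := LinearMap.toContinuousLinearMap f
  have hF : ∀ x, F x = f x := fun x => rfl
  -- Splitting y = x + (y - x) bounds the operator norm by M plus half of itself.
  have key : ∀ y, ‖y‖ ≤ 1 → ‖F y‖ ≤ M + ‖F‖ / 2 := by
    intro y hy
    obtain ⟨x, hx, hxy⟩ := hs y hy
    have h1 : ‖F (y - x)‖ ≤ ‖F‖ * (1 / 2) := (F.le_opNorm _).trans (by gcongr)
    have h2 : F y = F x + F (y - x) := by simp
    rw [h2]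
    refine (norm_add_le _ _).trans ?_
    have := hM x hx
    rw [← hF, ← Real.norm_eq_abs] at this
    linarith
  have hM0 : 0 ≤ M := by
    obtain ⟨x, hx, -⟩ := hs 0 (by simp)
    exact (abs_nonneg _).trans (hM x hx)
  have hn : ‖F‖ ≤ M + ‖F‖ / 2 := by
    refine ContinuousLinearMap.opNorm_le_of_unit_norm (by positivity) ?_
    intro y hy
    exact key y hy.le
  have := F.le_opNorm y
  rw [Real.norm_eq_abs, hF] at this
  refine this.trans ?_
  gcongr
  linarith

/-- A bilinear form is controlled by its values on a `1/2`-net of the unit ball. -/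
lemma abs_le_four_mul_of_net {d : ℕ} {s : Finset (EuclideanSpace ℝ (Fin d))}
    (hs : ∀ y : EuclideanSpace ℝ (Fin d), ‖y‖ ≤ 1 → ∃ x ∈ s, ‖y - x‖ ≤ 1 / 2)
    (B : EuclideanSpace ℝ (Fin d) →ₗ[ℝ] EuclideanSpace ℝ (Fin d) →ₗ[ℝ] ℝ) {M : ℝ}
    (hM : ∀ x ∈ s, ∀ y ∈ s, |B x y| ≤ M) (x y : EuclideanSpace ℝ (Fin d)) :
    |B x y| ≤ 4 * M * ‖x‖ * ‖y‖ := by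
  have h1 : ∀ x ∈ s, |B.flip y x| ≤ 2 * M * ‖y‖ := fun x hx =>
    abs_le_two_mul_of_net hs (B x) (hM x hx) y
  have := abs_le_two_mul_of_net hs (B.flip y) h1 x
  rw [LinearMap.flip_apply] at this
  linarith

/-! ### Perturbation of a rank-one matrix -/

/-- Pythagoras along `v`: the minimum over signs selects the sign of the inner product, leaving a
radial error and an angular error to be bounded separately. -/
lemma loss_smul_sq {d : ℕ} {θ v : EuclideanSpace ℝ (Fin d)} {r : ℝ} (hv : ‖v‖ = 1)
    (hr : 0 ≤ r) :
    loss (r • v) θ ^ 2 = (r - |inner ℝ θ v|) ^ 2 + (‖θ‖ ^ 2 - inner ℝ θ v ^ 2) := by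
  set p := inner ℝ θ v with hp
  have e1 : ‖r • v - θ‖ ^ 2 = r ^ 2 - 2 * r * p + ‖θ‖ ^ 2 := by
    rw [norm_sub_sq_real, norm_smul, hv, inner_smul_left, real_inner_comm]
    simp [← hp]; ring
  have e2 : ‖r • v + θ‖ ^ 2 = r ^ 2 + 2 * r * p + ‖θ‖ ^ 2 := by
    rw [norm_add_sq_real, norm_smul, hv, inner_smul_left, real_inner_comm]
    simp [← hp]; ring
  unfold loss
  rcases le_total 0 p with h | h
  · have := mul_nonneg hr h
    rw [min_eq_left (le_of_sq_le_sq (by rw [e1, e2]; linarith) (norm_nonneg _)), e1,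
      abs_of_nonneg h]
    ring
  · have := mul_nonpos_of_nonneg_of_nonpos hr h
    rw [min_eq_right (le_of_sq_le_sq (by rw [e1, e2]; linarith) (norm_nonneg _)), e2,
      abs_of_nonpos h]
    ring

/-- The squared sine of the angle between `θ` and an approximate eigenvector. -/
lemma norm_sq_mul_sub_inner_sq_le {d : ℕ} {θ v : EuclideanSpace ℝ (Fin d)} {b e : ℝ}
    (hv : ‖v‖ = 1) (hb : ‖θ‖ ^ 2 / 2 ≤ b)
    (h : ∀ x, inner ℝ θ x = 0 → |b * inner ℝ x v| ≤ e * ‖x‖) :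
    ‖θ‖ ^ 2 * (‖θ‖ ^ 2 - inner ℝ θ v ^ 2) ≤ 4 * e ^ 2 := by
  set p := inner ℝ θ v with hp
  set T := ‖θ‖ ^ 2 with hT
  have hG0 : 0 ≤ T - p ^ 2 := by
    have := abs_real_inner_le_norm θ v
    rw [hv, mul_one, ← hp] at this
    rw [← sq_abs p, hT]
    have := pow_le_pow_left₀ (abs_nonneg p) this 2
    linarith
  -- This is T times the component of v orthogonal to θ. Testing `h` against it avoids dividing by
  -- T, which may vanish.
  set w := T • v - p • θ with hw
  have hθw : inner ℝ θ w = 0 := by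
    rw [hw, inner_sub_right, inner_smul_right, inner_smul_right, real_inner_self_eq_norm_sq]
    rw [← hp, ← hT]; ring
  have hwv : inner ℝ w v = T - p ^ 2 := by
    rw [hw, inner_sub_left, inner_smul_left, inner_smul_left, real_inner_self_eq_norm_sq, hv]
    rw [← hp]; simp; ring
  have hw2 : ‖w‖ ^ 2 = T * (T - p ^ 2) := by
    rw [← real_inner_self_eq_norm_sq]
    nth_rewrite 2 [hw]
    rw [inner_sub_right, inner_smul_right, inner_smul_right, hwv, real_inner_comm, hθw]; ring
  have h6 := h w hθw
  rw [hwv] at h6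
  have h7 : T / 2 * (T - p ^ 2) ≤ e * ‖w‖ :=
    (mul_le_mul_of_nonneg_right hb hG0).trans ((le_abs_self _).trans h6)
  have h8 : ‖w‖ ^ 2 ≤ 2 * e * ‖w‖ := by rw [hw2]; linarith
  rw [← hw2]
  rcases (norm_nonneg w).eq_or_lt with h0 | h0
  · rw [← h0]; nlinarith [sq_nonneg e]
  · have h9 : ‖w‖ ≤ 2 * e := by
      rw [sq] at h8
      exact le_of_mul_le_mul_right h8 h0
    have := pow_le_pow_left₀ h0.le h9 2
    linarith [this, mul_pow 2 e 2]

/-- Perturbation bound: `v` is an approximate top eigenvector of `θ θᵀ` up to an error `e`, with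
eigenvalue `b`. -/
lemma loss_sq_le_of_perturbation {d : ℕ} {θ v : EuclideanSpace ℝ (Fin d)} {b e : ℝ}
    (hv : ‖v‖ = 1) (he0 : 0 ≤ e)
    (h1 : ∀ x, |b * inner ℝ x v - inner ℝ θ x * inner ℝ θ v| ≤ e * ‖x‖)
    (h2 : ‖θ‖ ^ 2 - e ≤ b) :
    loss (Real.sqrt (max b 0) • v) θ ^ 2 ≤ 3 * e ∧
      loss (Real.sqrt (max b 0) • v) θ ^ 2 * ‖θ‖ ^ 2 ≤ 12 * e ^ 2 := by
  have hr0 : 0 ≤ Real.sqrt (max b 0) := Real.sqrt_nonneg _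
  have hr2 : Real.sqrt (max b 0) ^ 2 = max b 0 := Real.sq_sqrt (by positivity)
  rw [loss_smul_sq hv hr0]
  set r := Real.sqrt (max b 0)
  have hang := fun hb : ‖θ‖ ^ 2 / 2 ≤ b => norm_sq_mul_sub_inner_sq_le (e := e) hv hb fun x hx => by
    have := h1 x
    rwa [hx, zero_mul, sub_zero] at this
  -- At x = v the hypothesis says that b is within e of p².
  have hpv := h1 v
  set p := inner ℝ θ v
  rw [real_inner_self_eq_norm_sq, hv] at hpv
  have hpv' : |b - p ^ 2| ≤ e := by
    convert hpv using 2 <;> ring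
  obtain ⟨hl, hu⟩ := abs_le.1 hpv'
  have hd1 : r ^ 2 ≤ p ^ 2 + e := by
    rw [hr2]; exact max_le (by linarith) (by positivity)
  have hd2 : p ^ 2 - e ≤ r ^ 2 := by
    rw [hr2]; exact le_max_of_le_left (by linarith)
  have hg : ‖θ‖ ^ 2 - p ^ 2 ≤ 2 * e := by linarith
  have hp0 := abs_nonneg p
  have hpp := sq_abs p
  have hfact : (r - |p|) * (r + |p|) = r ^ 2 - p ^ 2 := by rw [← hpp]; ring
  -- Both r and |p| are nonnegative, so (r - |p|)² ≤ |r² - p²|.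
  have hfirst : (r - |p|) ^ 2 ≤ e := by
    rcases le_total r |p| with h | h <;> nlinarith
  have hA : (r - |p|) ^ 2 + (‖θ‖ ^ 2 - p ^ 2) ≤ 3 * e := by linarith
  refine ⟨hA, ?_⟩
  set T := ‖θ‖ ^ 2
  have hT0 : 0 ≤ T := sq_nonneg _
  -- For T ≤ 4e the second bound follows from the first. Otherwise b and p² are at least T/2, so the
  -- radial and angular parts contribute 2e² and 4e².
  rcases le_or_gt T (4 * e) with hTe | hTe
  · calc ((r - |p|) ^ 2 + (T - p ^ 2)) * T ≤ (3 * e) * (4 * e) := by gcongr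
      _ = 12 * e ^ 2 := by ring
  · have hp2 : T / 2 ≤ p ^ 2 := by linarith
    have hrad : (r - |p|) ^ 2 * T ≤ 2 * e ^ 2 := by
      have h3 : (r - |p|) ^ 2 * (r + |p|) ^ 2 ≤ e ^ 2 := by
        rw [← mul_pow, hfact]
        exact sq_le_sq' (by linarith) (by linarith)
      have h5 : p ^ 2 ≤ (r + |p|) ^ 2 := by
        rw [← hpp]; exact pow_le_pow_left₀ hp0 (by linarith) 2
      have h6 : (r - |p|) ^ 2 * (T / 2) ≤ (r - |p|) ^ 2 * (r + |p|) ^ 2 :=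
        mul_le_mul_of_nonneg_left (hp2.trans h5) (sq_nonneg _)
      linarith
    have := hang (by linarith)
    have he2 := sq_nonneg e
    linarith

/-! ### Exponential moments of squares and Bernstein's inequality -/

section

/-- The weight turns the exponent -x²/2 into -3x²/8, that of a Gaussian of variance 4/3; the
normalizing constants differ by a factor √(4/3) ≤ 2. -/
lemma lintegral_exp_sq_div_eight_gaussianReal :
    ∫⁻ g, ENNReal.ofReal (Real.exp (g ^ 2 / 8)) ∂(gaussianReal 0 1) ≤ 2 := by
  rw [gaussianReal_of_var_ne_zero 0 one_ne_zero,
    lintegral_withDensity_eq_lintegral_mul _ (measurable_gaussianPDF 0 1) (by fun_prop)]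
  have h43 : (4 / 3 : NNReal) ≠ 0 := by norm_num
  have hpt : ∀ x : ℝ, gaussianPDFReal 0 1 x * Real.exp (x ^ 2 / 8)
      ≤ 2 * gaussianPDFReal 0 (4 / 3) x := by
    intro x
    rw [gaussianPDFReal_def, gaussianPDFReal_def]
    have h1 : (√(2 * Real.pi * ((1 : NNReal) : ℝ)))⁻¹
        ≤ 2 * (√(2 * Real.pi * ((4 / 3 : NNReal) : ℝ)))⁻¹ := by
      rw [inv_eq_one_div, ← div_eq_mul_inv, div_le_div_iff₀ (by positivity) (by positivity),
        one_mul]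
      have : (2 : ℝ) = √4 := by rw [show (4 : ℝ) = 2 ^ 2 by norm_num]; simp
      nth_rewrite 2 [this]
      rw [← Real.sqrt_mul (by norm_num)]
      apply Real.sqrt_le_sqrt
      push_cast
      nlinarith [Real.pi_pos]
    have h2 : Real.exp (-(x - 0) ^ 2 / (2 * ((1 : NNReal) : ℝ))) * Real.exp (x ^ 2 / 8)
        = Real.exp (-(x - 0) ^ 2 / (2 * ((4 / 3 : NNReal) : ℝ))) := by
      rw [← Real.exp_add]; congr 1; push_cast; ring
    simp only
    rw [mul_assoc, h2, ← mul_assoc]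
    gcongr
  calc ∫⁻ x, (gaussianPDF 0 1 * fun g => ENNReal.ofReal (Real.exp (g ^ 2 / 8))) x
      ≤ ∫⁻ x, 2 * ENNReal.ofReal (gaussianPDFReal 0 (4 / 3) x) := by
        refine lintegral_mono fun x => ?_
        rw [Pi.mul_apply, gaussianPDF, ← ENNReal.ofReal_mul (gaussianPDFReal_nonneg _ _ _),
          ← ENNReal.ofReal_ofNat 2, ← ENNReal.ofReal_mul (by norm_num)]
        exact ENNReal.ofReal_le_ofReal (hpt x)
    _ = 2 := by
        rw [lintegral_const_mul _ (by fun_prop), lintegral_gaussianPDFReal_eq_one 0 h43, mul_one]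

variable {Ω : Type*} [MeasurableSpace Ω] {μ : Measure Ω} [IsProbabilityMeasure μ]

/-- The square of a `1`-sub-Gaussian variable is exponentially integrable. -/
lemma lintegral_exp_sq_div_eight_le {X : Ω → ℝ} (hm : Measurable X)
    (hX : HasSubgaussianMGF X 1 μ) :
    ∫⁻ ω, ENNReal.ofReal (Real.exp (X ω ^ 2 / 8)) ∂μ ≤ 2 := by
  -- Gaussian linearization: exp(x²/8) is the Gaussian average of exp(xg/2). After Tonelli,
  -- sub-Gaussianity bounds the inner integral by exp(g²/8).
  have h1 : ∀ x : ℝ, ENNReal.ofReal (Real.exp (x ^ 2 / 8))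
      = ∫⁻ g, ENNReal.ofReal (Real.exp (x / 2 * g)) ∂(gaussianReal 0 1) := by
    intro x
    rw [← ofReal_integral_eq_lintegral_ofReal (integrable_exp_mul_gaussianReal _)
      (ae_of_all _ fun _ => (Real.exp_pos _).le)]
    have := congrFun (mgf_fun_id_gaussianReal (μ := 0) (v := 1)) (x / 2)
    rw [mgf] at this
    rw [this]
    congr 2; push_cast; ring
  simp_rw [h1]
  rw [lintegral_lintegral_swap (by fun_prop)]
  refine le_trans (lintegral_mono fun g => ?_) lintegral_exp_sq_div_eight_gaussianReal
  have h2 : ∀ ω, X ω / 2 * g = g / 2 * X ω := fun ω => by ring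
  simp_rw [h2]
  rw [← ofReal_integral_eq_lintegral_ofReal (hX.integrable_exp_mul _)
    (ae_of_all _ fun _ => (Real.exp_pos _).le)]
  refine ENNReal.ofReal_le_ofReal ((hX.mgf_le (g / 2)).trans (Real.exp_le_exp.2 ?_))
  push_cast
  nlinarith [sq_nonneg g]

lemma integrable_exp_sq_div_eight {X : Ω → ℝ} (hm : Measurable X)
    (hX : HasSubgaussianMGF X 1 μ) : Integrable (fun ω => Real.exp (X ω ^ 2 / 8)) μ := by
  refine ⟨by fun_prop, ?_⟩
  rw [hasFiniteIntegral_iff_ofReal (ae_of_all _ fun _ => (Real.exp_pos _).le)]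
  exact (lintegral_exp_sq_div_eight_le hm hX).trans_lt (by simp)

lemma integral_exp_sq_div_eight_le {X : Ω → ℝ} (hm : Measurable X)
    (hX : HasSubgaussianMGF X 1 μ) : ∫ ω, Real.exp (X ω ^ 2 / 8) ∂μ ≤ 2 := by
  rw [integral_eq_lintegral_of_nonneg_ae (ae_of_all _ fun _ => (Real.exp_pos _).le)
    (by fun_prop)]
  exact ENNReal.toReal_le_of_le_ofReal (by norm_num)
    ((lintegral_exp_sq_div_eight_le hm hX).trans (by simp))

lemma exp_le_one_add_add_sq_mul_exp_abs (x : ℝ) :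
    Real.exp x ≤ 1 + x + x ^ 2 * Real.exp |x| := by
  have h := Complex.norm_exp_sub_sum_le_norm_mul_exp (x : ℂ) 2
  have h2 : Complex.exp (x : ℂ) - ∑ m ∈ Finset.range 2, (x : ℂ) ^ m / (m.factorial : ℂ)
      = ((Real.exp x - (1 + x) : ℝ) : ℂ) := by
    simp [Finset.sum_range_succ]
  rw [h2, Complex.norm_real, Complex.norm_real, Real.norm_eq_abs, Real.norm_eq_abs, sq_abs] at h
  have := (le_abs_self _).trans h
  linarith

/-- Second-order Taylor bound with an integrable remainder. The factors y² and exp|sy| each cost one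
exp(|y|/16), and their product is at most exp(1/8) exp(x²/8). The constant is 1024 = 512 · 2. -/
lemma exp_mul_sq_sub_le {s m x : ℝ} (hs : |s| ≤ 1 / 16) (hm0 : 0 ≤ m) (hm1 : m ≤ 1) :
    Real.exp (s * (x ^ 2 - m)) ≤ 1 + s * (x ^ 2 - m) + 1024 * s ^ 2 * Real.exp (x ^ 2 / 8) := by
  set y := x ^ 2 - m with hy
  have hyabs : |y| ≤ x ^ 2 + 1 := abs_le.2 ⟨by nlinarith [sq_nonneg x], by linarith⟩
  refine (exp_le_one_add_add_sq_mul_exp_abs _).trans ?_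
  have h1 : y ^ 2 ≤ 512 * Real.exp (|y| / 16) := by
    have := Real.quadratic_le_exp_of_nonneg (x := |y| / 16) (by positivity)
    have h := sq_abs y
    have h' := abs_nonneg y
    nlinarith
  have h2 : |s * y| ≤ |y| / 16 := by
    rw [abs_mul]
    nlinarith [abs_nonneg y]
  have h3 : Real.exp (1 / 8) ≤ 2 := by
    have := Real.exp_bound_div_one_sub_of_interval (x := 1 / 8) (by norm_num) (by norm_num)
    exact this.trans (by norm_num)
  have h4 : Real.exp (|y| / 16) * Real.exp |s * y| ≤ 2 * Real.exp (x ^ 2 / 8) := by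
    rw [← Real.exp_add]
    calc Real.exp (|y| / 16 + |s * y|) ≤ Real.exp (1 / 8 + x ^ 2 / 8) :=
          Real.exp_le_exp.2 (by linarith)
      _ = Real.exp (1 / 8) * Real.exp (x ^ 2 / 8) := Real.exp_add _ _
      _ ≤ _ := by gcongr
  have h5 : (s * y) ^ 2 * Real.exp |s * y| ≤ 1024 * s ^ 2 * Real.exp (x ^ 2 / 8) := by
    calc (s * y) ^ 2 * Real.exp |s * y| = s ^ 2 * (y ^ 2 * Real.exp |s * y|) := by ring
      _ ≤ s ^ 2 * (512 * Real.exp (|y| / 16) * Real.exp |s * y|) := by gcongr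
      _ = 512 * s ^ 2 * (Real.exp (|y| / 16) * Real.exp |s * y|) := by ring
      _ ≤ 512 * s ^ 2 * (2 * Real.exp (x ^ 2 / 8)) := by gcongr
      _ = _ := by ring
  linarith

lemma integrable_exp_mul_sq_sub {X : Ω → ℝ} {s m : ℝ} (hm : Measurable X)
    (hX : HasSubgaussianMGF X 1 μ) (hs : |s| ≤ 1 / 16) (hm0 : 0 ≤ m) (hm1 : m ≤ 1) :
    Integrable (fun ω => Real.exp (s * (X ω ^ 2 - m))) μ := by
  have hsq : Integrable (fun ω => X ω ^ 2) μ := (hX.memLp 2).integrable_sq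
  refine Integrable.mono' (((integrable_const 1).add ((hsq.sub (integrable_const m)).const_mul s)).add
    ((integrable_exp_sq_div_eight hm hX).const_mul (1024 * s ^ 2))) (by fun_prop) ?_
  refine ae_of_all _ fun ω => ?_
  rw [Real.norm_eq_abs, abs_of_pos (Real.exp_pos _)]
  exact exp_mul_sq_sub_le hs hm0 hm1

/-- The centred square of a `1`-sub-Gaussian variable is sub-exponential. -/
lemma mgf_sq_sub_le {X : Ω → ℝ} {s m : ℝ} (hm : Measurable X)
    (hX : HasSubgaussianMGF X 1 μ) (hs : |s| ≤ 1 / 16) (hm0 : 0 ≤ m) (hm1 : m ≤ 1)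
    (hmean : ∫ ω, X ω ^ 2 ∂μ = m) :
    mgf (fun ω => X ω ^ 2 - m) μ s ≤ Real.exp (2048 * s ^ 2) := by
  have hsq : Integrable (fun ω => X ω ^ 2) μ := (hX.memLp 2).integrable_sq
  have hi0 : Integrable (fun ω => s * (X ω ^ 2 - m)) μ :=
    (hsq.sub (integrable_const m)).const_mul s
  have hi1 : Integrable (fun ω => 1 + s * (X ω ^ 2 - m)) μ := (integrable_const 1).add hi0
  have hi2 := (integrable_exp_sq_div_eight hm hX).const_mul (1024 * s ^ 2)
  calc mgf (fun ω => X ω ^ 2 - m) μ s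
      ≤ ∫ ω, (1 + s * (X ω ^ 2 - m) + 1024 * s ^ 2 * Real.exp (X ω ^ 2 / 8)) ∂μ :=
        integral_mono (integrable_exp_mul_sq_sub hm hX hs hm0 hm1) (hi1.add hi2)
          fun ω => exp_mul_sq_sub_le hs hm0 hm1
    _ = 1 + 1024 * s ^ 2 * ∫ ω, Real.exp (X ω ^ 2 / 8) ∂μ := by
        rw [integral_add hi1 hi2, integral_const_mul,
          integral_add (integrable_const 1) hi0,
          integral_const_mul, integral_sub hsq (integrable_const m), hmean]
        simp
    _ ≤ 1 + 1024 * s ^ 2 * 2 := by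
        have := integral_exp_sq_div_eight_le hm hX
        gcongr
    _ ≤ Real.exp (2048 * s ^ 2) := by
        have := Real.add_one_le_exp (2048 * s ^ 2)
        linarith

/-- Bernstein's inequality for squares of independent sub-Gaussian variables. -/
lemma measure_abs_sum_sq_sub_ge_le {l : ℕ} {X : Fin l → Ω → ℝ} {s m ε : ℝ}
    (hind : iIndepFun X μ) (hmeas : ∀ i, Measurable (X i))
    (hX : ∀ i, HasSubgaussianMGF (X i) 1 μ) (hs0 : 0 ≤ s) (hs : s ≤ 1 / 16)
    (hm0 : 0 ≤ m) (hm1 : m ≤ 1) (hmean : ∀ i, ∫ ω, X i ω ^ 2 ∂μ = m) :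
    μ.real {ω | ε ≤ |∑ i, (X i ω ^ 2 - m)|} ≤ 2 * Real.exp (-s * ε + 2048 * s ^ 2 * l) := by
  set Y : Fin l → Ω → ℝ := fun i ω => X i ω ^ 2 - m
  have hYind : iIndepFun Y μ := hind.comp (fun _ x => x ^ 2 - m) fun _ => by fun_prop
  have hYm : ∀ i, Measurable (Y i) := fun i => by fun_prop
  have hint : ∀ t, |t| ≤ 1 / 16 → Integrable (fun ω => Real.exp (t * (∑ i, Y i) ω)) μ :=
    fun t ht => hYind.integrable_exp_mul_sum hYm fun i _ =>
      integrable_exp_mul_sq_sub (hmeas i) (hX i) ht hm0 hm1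
  have hmgf : ∀ t, |t| ≤ 1 / 16 → mgf (∑ i, Y i) μ t ≤ Real.exp (2048 * t ^ 2 * l) := by
    intro t ht
    rw [hYind.mgf_sum hYm]
    calc ∏ i, mgf (Y i) μ t ≤ ∏ i : Fin l, Real.exp (2048 * t ^ 2) :=
          Finset.prod_le_prod (fun i _ => mgf_nonneg) fun i _ =>
            mgf_sq_sub_le (hmeas i) (hX i) ht hm0 hm1 (hmean i)
      _ = _ := by rw [Finset.prod_const, Finset.card_univ, Fintype.card_fin, ← Real.exp_nat_mul]
                  congr 1; ring
  have habs : |s| ≤ 1 / 16 := by rwa [abs_of_nonneg hs0]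
  have h1 := measure_ge_le_exp_mul_mgf ε hs0 (hint s habs)
  have h2 := measure_le_le_exp_mul_mgf (-ε) (neg_nonpos.2 hs0) (hint (-s) (by rwa [abs_neg]))
  have h3 : Real.exp (-s * ε) * mgf (∑ i, Y i) μ s ≤ Real.exp (-s * ε + 2048 * s ^ 2 * l) := by
    rw [Real.exp_add]; gcongr; exact hmgf s habs
  have h4 : Real.exp (-(-s) * -ε) * mgf (∑ i, Y i) μ (-s)
      ≤ Real.exp (-s * ε + 2048 * s ^ 2 * l) := by
    have := hmgf (-s) (by rwa [abs_neg])
    rw [neg_sq] at this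
    rw [Real.exp_add, show -(-s) * -ε = -s * ε by ring]; gcongr
  have hsub : {ω | ε ≤ |∑ i, (X i ω ^ 2 - m)|}
      ⊆ {ω | ε ≤ (∑ i, Y i) ω} ∪ {ω | (∑ i, Y i) ω ≤ -ε} := by
    intro ω hω
    simp only [Set.mem_ofPred_eq, Set.mem_union, Finset.sum_apply] at hω ⊢
    rcases le_abs.1 hω with h | h
    · exact Or.inl h
    · right; simp only [Y]; linarith
  calc _ ≤ _ := measureReal_mono hsub
    _ ≤ _ := measureReal_union_le _ _
    _ ≤ _ := by linarith

end

/-! ### Buckets and the covariance of the bucketed noise -/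

section

/-- The last bucket ends at `l * (n / l) ≤ n`, so no bucket is truncated. -/
lemma card_bucket {n l : ℕ} (i : Fin l) : (bucket n l i).card = bucketLength n l := by
  have hle : ((i : ℕ) + 1) * bucketLength n l ≤ n :=
    (Nat.mul_le_mul_right _ i.2).trans (by rw [mul_comm]; exact Nat.div_mul_le_self n l)
  have h : (bucket n l i).map Fin.valEmbedding
      = Finset.Ico ((i : ℕ) * bucketLength n l) (((i : ℕ) + 1) * bucketLength n l) := by
    ext a
    simp only [bucket, Finset.mem_map, Finset.mem_filter, Finset.mem_univ, true_and,
      Fin.valEmbedding_apply, Finset.mem_Ico]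
    constructor
    · rintro ⟨j, hj, rfl⟩; exact hj
    · intro ha; exact ⟨⟨a, by omega⟩, ha, rfl⟩
  rw [← Finset.card_map Fin.valEmbedding, h, Nat.card_Ico, add_mul, one_mul]
  omega

lemma disjoint_bucket {n l : ℕ} : Pairwise fun i j => Disjoint (bucket n l i) (bucket n l j) := by
  intro i j hij
  rw [Finset.disjoint_left]
  intro a ha hb
  simp only [bucket, Finset.mem_filter, Finset.mem_univ, true_and] at ha hb
  have hk : 0 < bucketLength n l := by
    rcases Nat.eq_zero_or_pos (bucketLength n l) with h | h
    · rw [h] at ha; omega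
    · exact h
  have h1 : (i : ℕ) < j + 1 := Nat.lt_of_mul_lt_mul_right (ha.1.trans_lt hb.2)
  have h2 : (j : ℕ) < i + 1 := Nat.lt_of_mul_lt_mul_right (hb.1.trans_lt ha.2)
  exact hij (Fin.ext (by omega))

lemma bucketLength_pos {n l : ℕ} (hl : 0 < l) (hln : l ≤ n) : 0 < bucketLength n l :=
  Nat.div_pos hln hl

lemma bucketMean_obs {Ω : Type*} {n d : ℕ} (η : Fin n → Ω → ℝ)
    (ξ : Fin n → Ω → EuclideanSpace ℝ (Fin d)) (θ : EuclideanSpace ℝ (Fin d)) (ω : Ω) (l : ℕ)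
    (i : Fin l) :
    bucketMean l (obs η ξ θ ω) i
      = bucketMean l (fun j => η j ω) i • θ + bucketMean l (fun j => ξ j ω) i := by
  simp only [bucketMean, obs, Finset.sum_add_distrib, smul_add, smul_eq_mul, ← Finset.sum_smul,
    smul_smul]

lemma abs_bucketMean_le {n l : ℕ} {h : Fin n → ℝ} (hh : ∀ j, |h j| ≤ 1) (i : Fin l) :
    |bucketMean l h i| ≤ 1 := by
  rw [bucketMean, smul_eq_mul, abs_mul, abs_inv, Nat.abs_cast]
  have : |∑ j ∈ bucket n l i, h j| ≤ bucketLength n l := by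
    refine (Finset.abs_sum_le_sum_abs _ _).trans ?_
    refine (Finset.sum_le_card_nsmul _ _ 1 fun j _ => hh j).trans ?_
    rw [card_bucket]; simp
  exact inv_mul_le_one_of_le₀ this (by positivity)

/-- The bucket means of the noise in direction `v`, rescaled to unit variance proxy. -/
def bucketProj {n d : ℕ} (l : ℕ) (v : EuclideanSpace ℝ (Fin d))
    (z : Fin n → EuclideanSpace ℝ (Fin d)) (i : Fin l) : ℝ :=
  (Real.sqrt (bucketLength n l))⁻¹ * ∑ j ∈ bucket n l i, inner ℝ v (z j)

lemma inner_bucketMean {n d : ℕ} {l : ℕ} (v : EuclideanSpace ℝ (Fin d))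
    (z : Fin n → EuclideanSpace ℝ (Fin d)) (i : Fin l) :
    inner ℝ v (bucketMean l z i) = (Real.sqrt (bucketLength n l))⁻¹ * bucketProj l v z i := by
  rw [bucketMean, inner_smul_right, inner_sum, bucketProj, ← mul_assoc, ← mul_inv,
    Real.mul_self_sqrt (Nat.cast_nonneg _)]

/-- A sub-Gaussian variable is centred. -/
lemma integral_eq_zero_of_hasSubgaussianMGF {Ω : Type*} [MeasurableSpace Ω] {μ : Measure Ω}
    [IsProbabilityMeasure μ] {X : Ω → ℝ} (hX : HasSubgaussianMGF X 1 μ) : ∫ ω, X ω ∂μ = 0 := by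
  -- Compare 1 + t E X ≤ E exp(tX) ≤ exp(t²/2) ≤ 1 + t². Taking t = ±r with r ≤ |m|/2 then forces m
  -- = 0.
  have key : ∀ t : ℝ, |t| ≤ 1 → t * ∫ ω, X ω ∂μ ≤ t ^ 2 := by
    intro t ht
    have h1 : ∫ ω, (1 + t * X ω) ∂μ ≤ mgf X μ t := by
      refine integral_mono ((integrable_const 1).add (hX.integrable.const_mul t))
        (hX.integrable_exp_mul t) fun ω => ?_
      have := Real.add_one_le_exp (t * X ω)
      simp only; linarith
    rw [integral_add (integrable_const 1) (hX.integrable.const_mul t), integral_const_mul] at h1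
    have h2 := h1.trans (hX.mgf_le t)
    have h3 : t ^ 2 / 2 ≤ 1 / 2 := by have := (sq_le_one_iff_abs_le_one t).2 ht; linarith
    have h4 := Real.exp_bound_div_one_sub_of_interval (x := t ^ 2 / 2) (by positivity)
      (by linarith)
    have h5 : 1 / (1 - t ^ 2 / 2) ≤ 1 + t ^ 2 := by
      rw [div_le_iff₀ (by linarith)]; nlinarith [sq_nonneg t, sq_nonneg (t ^ 2)]
    simp at h2
    linarith
  set m := ∫ ω, X ω ∂μ
  by_contra hm
  have hpos : 0 < |m| := abs_pos.2 hm
  set r := min 1 (|m| / 2) with hr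
  have hr0 : 0 < r := lt_min one_pos (by positivity)
  have hr1 : r ≤ 1 := min_le_left _ _
  have hr2 : r ≤ |m| / 2 := min_le_right _ _
  have habs : |r| ≤ 1 := by rwa [abs_of_pos hr0]
  have h1 := key r habs
  have h2 := key (-r) (by rwa [abs_neg])
  have h3 : r * |m| ≤ r ^ 2 := by
    rcases abs_cases m with ⟨h, -⟩ | ⟨h, -⟩ <;> rw [h] <;> nlinarith
  have h4 : |m| ≤ r := by
    rw [sq] at h3; exact le_of_mul_le_mul_left h3 hr0
  linarith

section Noise

variable {Ω : Type*} [MeasurableSpace Ω] {μ : Measure Ω} {n d : ℕ}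
  {ξ : Fin n → Ω → EuclideanSpace ℝ (Fin d)}

lemma IsSubGaussianNoise.hasSubgaussianMGF_inner (h : IsSubGaussianNoise μ ξ)
    {v : EuclideanSpace ℝ (Fin d)} (hv : ‖v‖ ≤ 1) (j : Fin n) :
    HasSubgaussianMGF (fun ω => inner ℝ v (ξ j ω)) 1 μ where
  integrable_exp_mul t := by
    simpa [inner_smul_left] using (h.subGaussian j (t • v)).1
  mgf_le t := by
    have := (h.subGaussian j (t • v)).2
    simp only [inner_smul_left, conj_trivial] at this
    refine this.trans (Real.exp_le_exp.2 ?_)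
    rw [norm_smul, mul_pow, Real.norm_eq_abs, sq_abs]
    push_cast
    have : ‖v‖ ^ 2 ≤ 1 := pow_le_one₀ (norm_nonneg _) hv
    nlinarith [sq_nonneg t]

lemma IsSubGaussianNoise.iIndepFun_inner (h : IsSubGaussianNoise μ ξ)
    (v : EuclideanSpace ℝ (Fin d)) : iIndepFun (fun j ω => inner ℝ v (ξ j ω)) μ :=
  h.indep.comp (fun _ x => inner ℝ v x) fun _ => by fun_prop

lemma IsSubGaussianNoise.measurable_bucketProj (h : IsSubGaussianNoise μ ξ)
    {l : ℕ} (v : EuclideanSpace ℝ (Fin d)) (i : Fin l) :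
    Measurable fun ω => bucketProj l v (fun j => ξ j ω) i := by
  have := h.measurable
  unfold bucketProj
  fun_prop

lemma IsSubGaussianNoise.hasSubgaussianMGF_bucketProj (h : IsSubGaussianNoise μ ξ)
    {l : ℕ} (hk : 0 < bucketLength n l) {v : EuclideanSpace ℝ (Fin d)} (hv : ‖v‖ ≤ 1)
    (i : Fin l) :
    HasSubgaussianMGF (fun ω => bucketProj l v (fun j => ξ j ω) i) 1 μ := by
  have h1 := HasSubgaussianMGF.sum_of_iIndepFun (h.iIndepFun_inner v) (s := bucket n l i)
    (c := fun _ => 1) fun j _ => h.hasSubgaussianMGF_inner hv j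
  have h2 := h1.const_mul (Real.sqrt (bucketLength n l))⁻¹
  convert h2 using 1
  · rfl
  rw [Finset.sum_const, card_bucket]
  ext
  have : (bucketLength n l : ℝ) ≠ 0 := by positivity
  change (1 : ℝ) = (√(bucketLength n l : ℝ))⁻¹ ^ 2 * ((bucketLength n l • (1 : NNReal) : NNReal) : ℝ)
  rw [inv_pow, Real.sq_sqrt (Nat.cast_nonneg _)]
  simp [this]

variable [IsProbabilityMeasure μ]

lemma IsSubGaussianNoise.iIndepFun_bucketProj (h : IsSubGaussianNoise μ ξ)
    (l : ℕ) (v : EuclideanSpace ℝ (Fin d)) :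
    iIndepFun (fun (i : Fin l) ω => bucketProj l v (fun j => ξ j ω) i) μ := by
  have h1 := iIndepFun_comp_disjoint h.indep h.measurable (bucket n l) disjoint_bucket
    (fun i z => (Real.sqrt (bucketLength n l))⁻¹ * ∑ j, inner ℝ v (z j)) (fun i => by fun_prop)
  convert h1 using 3
  rw [bucketProj, ← Finset.sum_coe_sort]

/-- Sub-Gaussian variables are centred, so second moments are variances, and these add over the
independent observations of a bucket. -/
lemma IsSubGaussianNoise.integral_bucketProj_sq (h : IsSubGaussianNoise μ ξ)
    {l : ℕ} (hk : 0 < bucketLength n l) {v : EuclideanSpace ℝ (Fin d)} (hv : ‖v‖ ≤ 1)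
    (i : Fin l) :
    ∫ ω, bucketProj l v (fun j => ξ j ω) i ^ 2 ∂μ = ‖v‖ ^ 2 := by
  have hs := h.hasSubgaussianMGF_inner hv
  have hm : ∀ j, Measurable fun ω => inner ℝ v (ξ j ω) := fun j => by
    have := h.measurable j; fun_prop
  have hvar : ∀ j, variance (fun ω => inner ℝ v (ξ j ω)) μ = ‖v‖ ^ 2 := fun j => by
    rw [variance_of_integral_eq_zero (hm j).aemeasurable
      (integral_eq_zero_of_hasSubgaussianMGF (hs j)), h.isotropic]
  have h1 := IndepFun.variance_sum (μ := μ) (s := bucket n l i)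
    (X := fun j ω => inner ℝ v (ξ j ω)) (fun j _ => (hs j).memLp 2)
    fun j _ j' _ hj => (h.iIndepFun_inner v).indepFun hj
  rw [variance_of_integral_eq_zero
    (Finset.aemeasurable_sum _ fun j _ => (hm j).aemeasurable)] at h1
  · simp only [hvar, Finset.sum_const, card_bucket, Finset.sum_apply] at h1
    simp only [bucketProj, mul_pow]
    rw [integral_const_mul, h1, inv_pow, Real.sq_sqrt (Nat.cast_nonneg _)]
    have : (bucketLength n l : ℝ) ≠ 0 := by positivity
    simp only [nsmul_eq_mul]
    field_simp
  · simp only [Finset.sum_apply]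
    rw [integral_finsetSum _ fun j _ => (hs j).integrable]
    exact Finset.sum_eq_zero fun j _ => integral_eq_zero_of_hasSubgaussianMGF (hs j)

/-- The deviation of the sample covariance of the bucketed noise, as a bilinear form. -/
def noiseForm {n d : ℕ} (l : ℕ) (z : Fin n → EuclideanSpace ℝ (Fin d)) :
    EuclideanSpace ℝ (Fin d) →ₗ[ℝ] EuclideanSpace ℝ (Fin d) →ₗ[ℝ] ℝ :=
  LinearMap.mk₂ ℝ
    (fun x y => (l : ℝ)⁻¹ * ∑ i : Fin l, inner ℝ x (bucketMean l z i) * inner ℝ y (bucketMean l z i)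
      - (bucketLength n l : ℝ)⁻¹ * inner ℝ x y)
    (fun x x' y => by
      simp only [inner_add_left, add_mul, Finset.sum_add_distrib]; ring)
    (fun c x y => by
      simp only [inner_smul_left, conj_trivial, mul_assoc, ← Finset.mul_sum, smul_eq_mul]; ring)
    (fun x y y' => by
      simp only [inner_add_left, inner_add_right, mul_add, Finset.sum_add_distrib]; ring)
    (fun c x y => by
      simp only [inner_smul_left, inner_smul_right, conj_trivial, mul_left_comm _ c,
        ← Finset.mul_sum, smul_eq_mul]; ring)

lemma noiseForm_apply (l : ℕ) (z : Fin n → EuclideanSpace ℝ (Fin d))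
    (x y : EuclideanSpace ℝ (Fin d)) :
    noiseForm l z x y
      = (l : ℝ)⁻¹ * ∑ i : Fin l, inner ℝ x (bucketMean l z i) * inner ℝ y (bucketMean l z i)
        - (bucketLength n l : ℝ)⁻¹ * inner ℝ x y := rfl

lemma noiseForm_self {l : ℕ} (hl : 0 < l) (z : Fin n → EuclideanSpace ℝ (Fin d))
    (x : EuclideanSpace ℝ (Fin d)) :
    noiseForm l z x x = (l : ℝ)⁻¹ * (bucketLength n l : ℝ)⁻¹
      * ∑ i : Fin l, (bucketProj l x z i ^ 2 - ‖x‖ ^ 2) := by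
  rw [noiseForm_apply, real_inner_self_eq_norm_sq, Finset.sum_sub_distrib]
  have h1 : ∀ i : Fin l, inner ℝ x (bucketMean l z i) * inner ℝ x (bucketMean l z i)
      = (bucketLength n l : ℝ)⁻¹ * bucketProj l x z i ^ 2 := fun i => by
    rw [inner_bucketMean, ← sq, mul_pow, inv_pow, Real.sq_sqrt (Nat.cast_nonneg _)]
  simp only [h1, ← Finset.mul_sum, Finset.sum_const, Finset.card_univ, Fintype.card_fin,
    nsmul_eq_mul]
  have : (l : ℝ) ≠ 0 := by positivity
  field_simp

lemma noiseForm_comm (l : ℕ) (z : Fin n → EuclideanSpace ℝ (Fin d))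
    (x y : EuclideanSpace ℝ (Fin d)) : noiseForm l z x y = noiseForm l z y x := by
  rw [noiseForm_apply, noiseForm_apply, real_inner_comm]
  simp only [mul_comm]

/-- Bernstein's inequality controls the diagonal of the form only. The factor 1/2 keeps half-sums
and half-differences of net points in the unit ball, where it applies. -/
lemma noiseForm_polarization (l : ℕ) (z : Fin n → EuclideanSpace ℝ (Fin d))
    (x y : EuclideanSpace ℝ (Fin d)) :
    noiseForm l z x y = noiseForm l z ((1 / 2 : ℝ) • (x + y)) ((1 / 2 : ℝ) • (x + y))
      - noiseForm l z ((1 / 2 : ℝ) • (x - y)) ((1 / 2 : ℝ) • (x - y)) := by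
  simp only [map_smul, map_add, map_sub, LinearMap.add_apply, LinearMap.sub_apply,
    LinearMap.smul_apply, smul_eq_mul]
  rw [noiseForm_comm l z y x]
  ring

lemma twenty_five_le_exp_four : (25 : ℝ) ≤ Real.exp 4 := by
  have h := Real.exp_one_gt_d9
  have : Real.exp 4 = Real.exp 1 ^ 4 := by rw [← Real.exp_nat_mul]; norm_num
  rw [this]
  calc (25 : ℝ) ≤ 2.7 ^ 4 := by norm_num
    _ ≤ _ := by gcongr; linarith

lemma five_le_exp_two : (5 : ℝ) ≤ Real.exp 2 := by
  have h := Real.exp_one_gt_d9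
  have : Real.exp 2 = Real.exp 1 ^ 2 := by rw [← Real.exp_nat_mul]; norm_num
  rw [this]
  calc (5 : ℝ) ≤ 2.7 ^ 2 := by norm_num
    _ ≤ _ := by gcongr; linarith

lemma IsSubGaussianNoise.measure_noiseForm_self_le (h : IsSubGaussianNoise μ ξ) {l : ℕ}
    (hl : 0 < l) (hdl : d ≤ l) (hln : l ≤ n) {v : EuclideanSpace ℝ (Fin d)} (hv : ‖v‖ ≤ 1) :
    μ.real {ω | 208 * (bucketLength n l : ℝ)⁻¹ * √((d : ℝ) / l)
      < |noiseForm l (fun j => ξ j ω) v v|} ≤ 2 * Real.exp (-(5 * d)) := by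
  have hk := bucketLength_pos hl hln
  have hl' : (0 : ℝ) < l := by positivity
  have hk' : (0 : ℝ) < bucketLength n l := by positivity
  set r := √((d : ℝ) / l) with hr
  have hr0 : 0 ≤ r := Real.sqrt_nonneg _
  have hr2 : r ^ 2 * l = d := by rw [hr, Real.sq_sqrt (by positivity)]; field_simp
  have hr1 : r ≤ 1 := by
    refine Real.sqrt_le_one.2 ?_
    rw [div_le_one hl']; exact_mod_cast hdl
  have hb := measure_abs_sum_sq_sub_ge_le (μ := μ) (s := r / 16) (m := ‖v‖ ^ 2)
    (ε := 208 * l * r) (h.iIndepFun_bucketProj l v) (h.measurable_bucketProj v)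
    (h.hasSubgaussianMGF_bucketProj hk hv) (by positivity) (by linarith) (by positivity)
    (pow_le_one₀ (norm_nonneg _) hv) (h.integral_bucketProj_sq hk hv)
  -- The tilt r/16 is admissible since d ≤ l gives r ≤ 1. The constant 208 yields the exponent (-13
  -- + 8)d = -5d, enough for a union bound over 2 · 25^d points, as 25 ≤ e⁴.
  have he : -(r / 16) * (208 * l * r) + 2048 * (r / 16) ^ 2 * l = -(5 * d) := by
    rw [← hr2]; ring
  rw [he] at hb
  refine (measureReal_mono ?_).trans hb
  intro ω hω
  simp only [Set.mem_ofPred_eq] at hω ⊢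
  rw [noiseForm_self hl, abs_mul, abs_of_pos (by positivity)] at hω
  have := mul_lt_mul_of_pos_left hω (mul_pos hl' hk')
  refine le_of_lt ?_
  calc 208 * (l : ℝ) * r
      = l * bucketLength n l * (208 * (bucketLength n l : ℝ)⁻¹ * r) := by field_simp
    _ < _ := this
    _ = _ := by field_simp

/-- Operator norm deviation of the sample covariance of the bucketed noise. -/
lemma IsSubGaussianNoise.measure_noiseForm_le (h : IsSubGaussianNoise μ ξ) {l : ℕ}
    (hl : 0 < l) (hdl : d ≤ l) (hln : l ≤ n) :
    μ.real {ω | ¬ ∀ x y, |noiseForm l (fun j => ξ j ω) x y|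
      ≤ 1664 * ((bucketLength n l : ℝ)⁻¹ * √((d : ℝ) / l)) * ‖x‖ * ‖y‖}
      ≤ 4 * Real.exp (-d) := by
  classical
  obtain ⟨s, hcard, hs1, hs⟩ := exists_half_net d
  let t := (s ×ˢ s).image (fun p => (1 / 2 : ℝ) • (p.1 + p.2))
    ∪ (s ×ˢ s).image (fun p => (1 / 2 : ℝ) • (p.1 - p.2))
  have ht : t.card ≤ 2 * 25 ^ d := by
    have h1 : (s ×ˢ s).card ≤ 25 ^ d := by
      rw [Finset.card_product, show 25 = 5 * 5 by norm_num, mul_pow]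
      exact Nat.mul_le_mul hcard hcard
    refine (Finset.card_union_le _ _).trans ?_
    have h2 := (Finset.card_image_le (s := s ×ˢ s)
      (f := fun p => (1 / 2 : ℝ) • (p.1 + p.2))).trans h1
    have h3 := (Finset.card_image_le (s := s ×ˢ s)
      (f := fun p => (1 / 2 : ℝ) • (p.1 - p.2))).trans h1
    omega
  have htn : ∀ v ∈ t, ‖v‖ ≤ 1 := by
    intro v hv
    rcases Finset.mem_union.1 hv with hv | hv <;> obtain ⟨p, hp, rfl⟩ := Finset.mem_image.1 hv <;>
      obtain ⟨hp1, hp2⟩ := Finset.mem_product.1 hp <;> rw [norm_smul]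
    · have := norm_add_le p.1 p.2
      have := hs1 _ hp1; have := hs1 _ hp2
      norm_num; linarith
    · have := norm_sub_le p.1 p.2
      have := hs1 _ hp1; have := hs1 _ hp2
      norm_num; linarith
  have hadd : ∀ x ∈ s, ∀ y ∈ s, (1 / 2 : ℝ) • (x + y) ∈ t := fun x hx y hy =>
    Finset.mem_union_left _ (Finset.mem_image.2 ⟨(x, y), Finset.mk_mem_product hx hy, rfl⟩)
  have hsubt : ∀ x ∈ s, ∀ y ∈ s, (1 / 2 : ℝ) • (x - y) ∈ t := fun x hx y hy =>
    Finset.mem_union_right _ (Finset.mem_image.2 ⟨(x, y), Finset.mk_mem_product hx hy, rfl⟩)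
  clear_value t
  set T := (bucketLength n l : ℝ)⁻¹ * √((d : ℝ) / l) with hT
  have hsub : {ω | ¬ ∀ x y, |noiseForm l (fun j => ξ j ω) x y| ≤ 1664 * T * ‖x‖ * ‖y‖}
      ⊆ ⋃ v ∈ t, {ω | 208 * (bucketLength n l : ℝ)⁻¹ * √((d : ℝ) / l)
        < |noiseForm l (fun j => ξ j ω) v v|} := by
    intro ω hω
    by_contra hc
    simp only [Set.mem_iUnion, Set.mem_ofPred_eq, not_exists, not_lt] at hc
    apply hω
    intro x y
    -- Polarization doubles 208 to 416, and the net argument in two variables multiplies by 4.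
    refine (abs_le_four_mul_of_net hs (noiseForm l fun j => ξ j ω) (M := 416 * T) ?_ x y).trans
      (le_of_eq (by ring))
    intro x hx y hy
    have h1 := hc _ (hadd x hx y hy)
    have h2 := hc _ (hsubt x hx y hy)
    rw [noiseForm_polarization]
    refine (abs_sub _ _).trans ?_
    rw [mul_assoc, ← hT] at h1 h2
    linarith
  calc _ ≤ _ := measureReal_mono hsub (measure_ne_top _ _)
    _ ≤ _ := measureReal_biUnion_finset_le _ _
    _ ≤ ∑ v ∈ t, 2 * Real.exp (-(5 * d)) :=
        Finset.sum_le_sum fun v hv => h.measure_noiseForm_self_le hl hdl hln (htn v hv)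
    _ = t.card * (2 * Real.exp (-(5 * d))) := by rw [Finset.sum_const, nsmul_eq_mul]
    _ ≤ (2 * Real.exp 4 ^ d) * (2 * Real.exp (-(5 * d))) := by
        gcongr
        calc (t.card : ℝ) ≤ 2 * 25 ^ d := by exact_mod_cast ht
          _ ≤ _ := by have := twenty_five_le_exp_four; gcongr
    _ = 4 * (Real.exp (d * 4) * Real.exp (-(5 * d))) := by rw [Real.exp_nat_mul]; ring
    _ = 4 * Real.exp (-d) := by rw [← Real.exp_add]; congr 2; ring

end Noise

end

/-! ### The cross term between labels and noise -/

section

lemma hasSubgaussianMGF_mono {Ω : Type*} [MeasurableSpace Ω] {μ : Measure Ω} {X : Ω → ℝ}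
    {c c' : NNReal} (hX : HasSubgaussianMGF X c μ) (hc : c ≤ c') : HasSubgaussianMGF X c' μ where
  integrable_exp_mul := hX.integrable_exp_mul
  mgf_le t := (hX.mgf_le t).trans (Real.exp_le_exp.2 (by
    have : (c : ℝ) ≤ c' := hc
    gcongr))

lemma measureReal_abs_gt_le {Ω : Type*} [MeasurableSpace Ω] {μ : Measure Ω}
    [IsProbabilityMeasure μ] {X : Ω → ℝ} {c : NNReal} (hX : HasSubgaussianMGF X c μ) {ε : ℝ}
    (hε : 0 ≤ ε) : μ.real {ω | ε < |X ω|} ≤ 2 * Real.exp (-ε ^ 2 / (2 * c)) := by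
  have h1 := hX.measure_ge_le hε
  have h2 := hX.neg.measure_ge_le hε
  have hsub : {ω | ε < |X ω|} ⊆ {ω | ε ≤ X ω} ∪ {ω | ε ≤ (-X) ω} := by
    intro ω hω
    rw [Set.mem_ofPred_eq] at hω
    rcases lt_abs.1 hω with h | h
    · exact Or.inl h.le
    · exact Or.inr h.le
  calc _ ≤ _ := measureReal_mono hsub
    _ ≤ _ := measureReal_union_le _ _
    _ ≤ _ := by linarith

/-- The cross term `ℓ⁻¹ ∑ᵢ h̄ᵢ z̄ᵢ`. -/
def crossVec {n d : ℕ} (l : ℕ) (h : Fin n → ℝ) (z : Fin n → EuclideanSpace ℝ (Fin d)) :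
    EuclideanSpace ℝ (Fin d) :=
  (l : ℝ)⁻¹ • ∑ i : Fin l, bucketMean l h i • bucketMean l z i

lemma measurable_crossVec {n d : ℕ} (l : ℕ) :
    Measurable fun p : (Fin n → ℝ) × (Fin n → EuclideanSpace ℝ (Fin d)) =>
      crossVec l p.1 p.2 := by
  unfold crossVec bucketMean
  simp only [smul_eq_mul]
  fun_prop

lemma inner_crossVec {n d : ℕ} {l : ℕ} (h : Fin n → ℝ) (z : Fin n → EuclideanSpace ℝ (Fin d))
    (x : EuclideanSpace ℝ (Fin d)) :
    inner ℝ x (crossVec l h z) = (l : ℝ)⁻¹ * (√(bucketLength n l : ℝ))⁻¹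
      * ∑ i : Fin l, bucketMean l h i * bucketProj l x z i := by
  simp only [crossVec, inner_smul_right, inner_sum, inner_bucketMean, Finset.mul_sum]
  exact Finset.sum_congr rfl fun i _ => by ring

section

variable {Ω : Type*} [MeasurableSpace Ω] {μ : Measure Ω} [IsProbabilityMeasure μ] {n d : ℕ}
  {ξ : Fin n → Ω → EuclideanSpace ℝ (Fin d)}

lemma IsSubGaussianNoise.measure_inner_crossVec_le (hξ : IsSubGaussianNoise μ ξ) {l : ℕ}
    (hl : 0 < l) (hln : l ≤ n) {h : Fin n → ℝ} (hh : ∀ j, |h j| ≤ 1)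
    {x : EuclideanSpace ℝ (Fin d)} (hx : ‖x‖ ≤ 1) :
    μ.real {ω | 3 * √((d : ℝ) / (l * bucketLength n l))
      < |inner ℝ x (crossVec l h fun j => ξ j ω)|} ≤ 2 * Real.exp (-(3 * d)) := by
  have hk := bucketLength_pos hl hln
  have hl' : (0 : ℝ) < l := by positivity
  have hk' : (0 : ℝ) < bucketLength n l := by positivity
  have hind : iIndepFun
      (fun (i : Fin l) ω => bucketMean l h i * bucketProj l x (fun j => ξ j ω) i) μ :=
    (hξ.iIndepFun_bucketProj l x).comp (fun i y => bucketMean l h i * y) fun i => by fun_prop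
  have hsub := HasSubgaussianMGF.sum_of_iIndepFun hind (s := Finset.univ) (c := fun _ => 1)
    fun i _ => hasSubgaussianMGF_mono
      ((hξ.hasSubgaussianMGF_bucketProj hk hx i).const_mul (bucketMean l h i)) (by
        change bucketMean l h i ^ 2 * 1 ≤ (1 : ℝ)
        rw [mul_one]
        exact (sq_le_one_iff_abs_le_one _).2 (abs_bucketMean_le hh i))
  -- The variance proxy of the sum is l, so the exponent is 9d/2 ≥ 3d; a net of 5^d ≤ e^{2d} points
  -- leaves e^{-d}.
  have hb := measureReal_abs_gt_le hsub (ε := 3 * √(d * l)) (by positivity)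
  refine (measureReal_mono ?_).trans (hb.trans ?_)
  · intro ω hω
    simp only [Set.mem_ofPred_eq] at hω ⊢
    rw [inner_crossVec, abs_mul, abs_of_pos (by positivity)] at hω
    have h1 : √((d : ℝ) * l) = l * √(bucketLength n l : ℝ) * √((d : ℝ) / (l * bucketLength n l)) := by
      have : (d : ℝ) * l = l ^ 2 * (bucketLength n l * (d / (l * bucketLength n l))) := by
        field_simp
      rw [this, Real.sqrt_mul (by positivity), Real.sqrt_sq hl'.le, Real.sqrt_mul hk'.le]
      ring
    have h2 : 0 < l * √(bucketLength n l : ℝ) := by positivity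
    have := mul_lt_mul_of_pos_left hω h2
    have hs : √(bucketLength n l : ℝ) ≠ 0 := by positivity
    calc 3 * √((d : ℝ) * l)
        = l * √(bucketLength n l : ℝ) * (3 * √((d : ℝ) / (l * bucketLength n l))) := by
          rw [h1]; ring
      _ < _ := this
      _ = _ := by field_simp
  · gcongr
    simp only [Finset.sum_const, Finset.card_univ, Fintype.card_fin, nsmul_eq_mul, mul_one,
      NNReal.coe_natCast, mul_pow]
    rw [Real.sq_sqrt (by positivity), div_le_iff₀ (by positivity)]
    have : (0 : ℝ) ≤ d * l := by positivity
    linarith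

lemma IsSubGaussianNoise.measure_norm_crossVec_le (hξ : IsSubGaussianNoise μ ξ) {l : ℕ}
    (hl : 0 < l) (hln : l ≤ n) {h : Fin n → ℝ} (hh : ∀ j, |h j| ≤ 1) :
    μ.real {ω | 6 * √((d : ℝ) / (l * bucketLength n l)) < ‖crossVec l h fun j => ξ j ω‖}
      ≤ 2 * Real.exp (-d) := by
  obtain ⟨s, hcard, hs1, hs⟩ := exists_half_net d
  set T := √((d : ℝ) / (l * bucketLength n l)) with hT
  have hT0 : 0 ≤ T := Real.sqrt_nonneg _
  have hsub : {ω | 6 * T < ‖crossVec l h fun j => ξ j ω‖}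
      ⊆ ⋃ x ∈ s, {ω | 3 * T < |inner ℝ x (crossVec l h fun j => ξ j ω)|} := by
    intro ω hω
    by_contra hc
    simp only [Set.mem_iUnion, Set.mem_ofPred_eq, not_exists, not_lt] at hc hω
    set u := crossVec l h fun j => ξ j ω
    -- The functional ⟨u, ·⟩ is evaluated at u itself, giving ‖u‖² ≤ 6T‖u‖.
    have := abs_le_two_mul_of_net hs (innerₗ _ u) (M := 3 * T)
      (fun x hx => by rw [innerₗ_apply_apply, real_inner_comm]; exact hc x hx) u
    rw [innerₗ_apply_apply, real_inner_self_eq_norm_sq, abs_of_nonneg (sq_nonneg _), sq] at this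
    have hu : 0 < ‖u‖ := by linarith
    have := le_of_mul_le_mul_right this hu
    linarith
  calc _ ≤ _ := measureReal_mono hsub (measure_ne_top _ _)
    _ ≤ _ := measureReal_biUnion_finset_le _ _
    _ ≤ ∑ x ∈ s, 2 * Real.exp (-(3 * d)) :=
        Finset.sum_le_sum fun x hx => hξ.measure_inner_crossVec_le hl hln hh (hs1 x hx)
    _ = s.card * (2 * Real.exp (-(3 * d))) := by rw [Finset.sum_const, nsmul_eq_mul]
    _ ≤ Real.exp 2 ^ d * (2 * Real.exp (-(3 * d))) := by
        gcongr
        calc (s.card : ℝ) ≤ 5 ^ d := by exact_mod_cast hcard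
          _ ≤ _ := by have := five_le_exp_two; gcongr
    _ = 2 * (Real.exp (d * 2) * Real.exp (-(3 * d))) := by rw [Real.exp_nat_mul]; ring
    _ = 2 * Real.exp (-d) := by rw [← Real.exp_add]; congr 2; ring

/-- The norm of the cross term between labels and noise. -/
lemma IsModel.measure_norm_crossVec_le {δ : ℝ} {η : Fin n → Ω → ℝ} (hM : IsModel μ δ η ξ) {l : ℕ}
    (hl : 0 < l) (hln : l ≤ n) :
    μ {ω | 6 * √((d : ℝ) / (l * bucketLength n l))
      < ‖crossVec l (fun j => η j ω) fun j => ξ j ω‖} ≤ ENNReal.ofReal (2 * Real.exp (-d)) := by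
  have hηm : Measurable fun ω i => η i ω := measurable_pi_lambda _ hM.chain.measurable
  have hξm : Measurable fun ω i => ξ i ω := measurable_pi_lambda _ hM.noise.measurable
  let S : Set ((Fin n → ℝ) × (Fin n → EuclideanSpace ℝ (Fin d))) :=
    {p | 6 * √((d : ℝ) / (l * bucketLength n l)) < ‖crossVec l p.1 p.2‖}
  have hS : MeasurableSet S := measurableSet_lt measurable_const (measurable_crossVec l).norm
  -- The joint law is a product, so the bound for frozen labels, uniform over |h j| ≤ 1, integrates
  -- over the law of the labels.
  have hmap := hM.indep.map_prod_eq_prod_map_map hηm.aemeasurable hξm.aemeasurable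
  have : IsProbabilityMeasure (μ.map fun ω i => η i ω) :=
    Measure.isProbabilityMeasure_map hηm.aemeasurable
  have : IsProbabilityMeasure (μ.map fun ω i => ξ i ω) :=
    Measure.isProbabilityMeasure_map hξm.aemeasurable
  have h1 : μ {ω | 6 * √((d : ℝ) / (l * bucketLength n l))
      < ‖crossVec l (fun j => η j ω) fun j => ξ j ω‖}
      = (μ.map fun ω => ((fun i => η i ω), fun i => ξ i ω)) S := by
    rw [Measure.map_apply (hηm.prodMk hξm) hS]; rfl
  rw [h1, hmap, Measure.prod_apply hS]
  have h2 : ∀ᵐ h ∂(μ.map fun ω i => η i ω), (μ.map fun ω i => ξ i ω) (Prod.mk h ⁻¹' S)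
      ≤ ENNReal.ofReal (2 * Real.exp (-d)) := by
    have h3 : ∀ᵐ h ∂(μ.map fun ω i => η i ω), ∀ j, |h j| ≤ 1 := by
      rw [ae_map_iff hηm.aemeasurable
        (by simp only [Set.ofPred_forall]
            exact MeasurableSet.iInter fun j => measurableSet_le (by fun_prop) (by fun_prop))]
      filter_upwards [ae_all_iff.2 hM.chain.label] with ω hω j
      rcases hω j with h | h <;> simp [h]
    filter_upwards [h3] with h hh
    rw [Measure.map_apply hξm (measurable_prodMk_left hS)]
    have := hM.noise.measure_norm_crossVec_le hl hln hh
    rw [← ofReal_measureReal]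
    exact ENNReal.ofReal_le_ofReal this
  calc _ ≤ ∫⁻ _, ENNReal.ofReal (2 * Real.exp (-d)) ∂(μ.map fun ω i => η i ω) :=
        lintegral_mono_ae h2
    _ = _ := by simp

end

end

/-! ### Independence of the increments of the chain -/

section

variable {Ω : Type*} [MeasurableSpace Ω] {μ : Measure Ω} {n : ℕ} {η : Fin n → Ω → ℝ} {δ : ℝ}

open Classical in
/-- The increments of a chain of labels: whether the label equals the previous one (or equals `1`,
for the first label). -/
def increment (η : Fin n → Ω → ℝ) (j : Fin n) (ω : Ω) : Bool :=
  decide (η j ω = if (j : ℕ) = 0 then 1 else η ⟨j - 1, by omega⟩ ω)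

/-- The law of the increments of a symmetric chain. -/
def incrementLaw (δ : ℝ) (j : Fin n) : Measure Bool :=
  ENNReal.ofReal (if (j : ℕ) = 0 then 1 / 2 else 1 - δ) • Measure.dirac true +
    ENNReal.ofReal (if (j : ℕ) = 0 then 1 / 2 else δ) • Measure.dirac false

lemma incrementLaw_singleton (j : Fin n) (b : Bool) :
    incrementLaw δ j {b} = ENNReal.ofReal
      (if (j : ℕ) = 0 then 1 / 2 else if b then 1 - δ else δ) := by
  cases b <;> simp [incrementLaw]

lemma isProbabilityMeasure_incrementLaw (h0 : 0 < δ) (h1 : δ < 1 / 2) (j : Fin n) :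
    IsProbabilityMeasure (incrementLaw δ j) where
  measure_univ := by
    simp only [incrementLaw, Measure.add_apply, Measure.smul_apply, measure_univ, smul_eq_mul,
      mul_one]
    rw [← ENNReal.ofReal_add (by split_ifs <;> linarith) (by split_ifs <;> linarith)]
    split_ifs <;> norm_num

lemma IsSymmetricChain.measurable_increment (h : IsSymmetricChain μ δ η) (j : Fin n) :
    Measurable (increment η j) := by
  refine measurable_to_bool ?_
  have hm := h.measurable
  have : increment η j ⁻¹' {true}
      = {ω | η j ω = if (j : ℕ) = 0 then 1 else η ⟨j - 1, by omega⟩ ω} := by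
    ext ω; simp [increment]
  rw [this]
  refine measurableSet_eq_fun (hm j) ?_
  split_ifs
  exacts [measurable_const, hm _]

/-- For ±1 labels, a path and its increments determine each other. This translates increment events
into the path events that `flip` and `stay` speak of. -/
lemma IsSymmetricChain.exists_prefix (h : IsSymmetricChain μ δ η) (s : Fin n → Bool) (i : ℕ)
    (hi : i < n) : ∃ t : Fin n → ℝ, ∀ᵐ ω ∂μ,
      (∀ m ≤ (⟨i, hi⟩ : Fin n), increment η m ω = s m) ↔ ∀ m ≤ (⟨i, hi⟩ : Fin n), η m ω = t m := by
  induction i with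
  | zero =>
    refine ⟨fun _ => if s ⟨0, hi⟩ then 1 else -1, ?_⟩
    filter_upwards [h.label ⟨0, hi⟩] with ω hω
    have hz : ∀ m : Fin n, m ≤ ⟨0, hi⟩ ↔ m = ⟨0, hi⟩ := fun m => by
      simp [Fin.le_def, Fin.ext_iff]
    simp only [hz, forall_eq, increment]
    rcases hω with hω | hω <;> cases s ⟨0, hi⟩ <;> simp [hω] <;> norm_num
  | succ i ih =>
    have hi' : i < n := by omega
    obtain ⟨t, ht⟩ := ih hi'
    refine ⟨Function.update t ⟨i + 1, hi⟩ (if s ⟨i + 1, hi⟩ then t ⟨i, hi'⟩ else -t ⟨i, hi'⟩), ?_⟩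
    filter_upwards [ht, h.label ⟨i, hi'⟩, h.label ⟨i + 1, hi⟩] with ω hω h1 h2
    have hz : ∀ m : Fin n, m ≤ ⟨i + 1, hi⟩ ↔ m ≤ ⟨i, hi'⟩ ∨ m = ⟨i + 1, hi⟩ := fun m => by
      simp only [Fin.le_def, Fin.ext_iff]; omega
    simp only [hz, or_imp, forall_and, forall_eq, hω, Function.update_self]
    have hne : ∀ m : Fin n, m ≤ ⟨i, hi'⟩ → m ≠ ⟨i + 1, hi⟩ := fun m hm hc => by
      simp only [Fin.le_def, Fin.ext_iff] at hm hc; omega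
    have hupd : (∀ m ≤ (⟨i, hi'⟩ : Fin n), η m ω
        = Function.update t ⟨i + 1, hi⟩ (if s ⟨i + 1, hi⟩ then t ⟨i, hi'⟩ else -t ⟨i, hi'⟩) m)
        ↔ ∀ m ≤ (⟨i, hi'⟩ : Fin n), η m ω = t m :=
      forall₂_congr fun m hm => by rw [Function.update_of_ne (hne m hm)]
    rw [hupd]
    refine and_congr_right fun hp => ?_
    have hti := hp ⟨i, hi'⟩ le_rfl
    rw [← hti]
    simp only [increment, Nat.add_sub_cancel]
    rcases h1 with h1 | h1 <;> rcases h2 with h2 | h2 <;> cases s ⟨i + 1, hi⟩ <;>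
      simp [h1, h2] <;> norm_num

/-- Each new increment multiplies the probability by δ or 1 - δ whatever the past path was; the
resulting product form is independence. -/
lemma IsSymmetricChain.measure_prefix (h : IsSymmetricChain μ δ η)
    (s : Fin n → Bool) (i : ℕ) (hi : i < n) :
    μ.real {ω | ∀ m ≤ (⟨i, hi⟩ : Fin n), increment η m ω = s m}
      = ∏ m ∈ Finset.univ.filter (· ≤ (⟨i, hi⟩ : Fin n)),
        (if (m : ℕ) = 0 then 1 / 2 else if s m then 1 - δ else δ) := by
  induction i with
  | zero =>
    have hz : ∀ m : Fin n, m ≤ ⟨0, hi⟩ ↔ m = ⟨0, hi⟩ := fun m => by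
      simp [Fin.le_def, Fin.ext_iff]
    simp only [hz, forall_eq, Finset.filter_eq', Finset.mem_univ, if_true, Finset.prod_singleton]
    have hinit := h.init ⟨0, hi⟩ rfl
    cases hs : s ⟨0, hi⟩
    · rw [← hinit.2]
      refine measureReal_congr ?_
      filter_upwards [h.label ⟨0, hi⟩] with ω hω
      refine propext ?_
      change increment η ⟨0, hi⟩ ω = false ↔ η ⟨0, hi⟩ ω = -1
      simp only [increment]
      rcases hω with hω | hω <;> simp [hω] <;> norm_num
    · rw [← hinit.1]
      congr 1
      ext ω
      simp [increment]
  | succ i ih =>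
    have hi' : i < n := by omega
    obtain ⟨t, ht⟩ := h.exists_prefix s i hi'
    have hz : ∀ m : Fin n, m ≤ ⟨i + 1, hi⟩ ↔ m = ⟨i + 1, hi⟩ ∨ m ≤ ⟨i, hi'⟩ := fun m => by
      simp only [Fin.le_def, Fin.ext_iff]; omega
    have hfil : Finset.univ.filter (· ≤ (⟨i + 1, hi⟩ : Fin n))
        = insert ⟨i + 1, hi⟩ (Finset.univ.filter (· ≤ (⟨i, hi'⟩ : Fin n))) := by
      ext m; simp [hz]
    rw [hfil, Finset.prod_insert (by simp [Fin.le_def]), ← ih hi']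
    have hpre : μ.real {ω | ∀ m ≤ (⟨i, hi'⟩ : Fin n), increment η m ω = s m}
        = μ.real {ω | ∀ m ≤ (⟨i, hi'⟩ : Fin n), η m ω = t m} :=
      measureReal_congr (by filter_upwards [ht] with ω hω; exact propext hω)
    rw [hpre]
    simp only [Nat.add_one_ne_zero, if_false]
    cases hs : s ⟨i + 1, hi⟩
    · have := h.flip ⟨i, hi'⟩ ⟨i + 1, hi⟩ rfl t
      simp only [Bool.false_eq_true, if_false]
      rw [← this]
      refine measureReal_congr ?_
      filter_upwards [ht, h.label ⟨i, hi'⟩, h.label ⟨i + 1, hi⟩] with ω hω l1 l2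
      refine propext ?_
      change (∀ m ≤ (⟨i + 1, hi⟩ : Fin n), increment η m ω = s m) ↔
        (∀ m ≤ (⟨i, hi'⟩ : Fin n), η m ω = t m) ∧ η ⟨i + 1, hi⟩ ω = -η ⟨i, hi'⟩ ω
      simp only [hz, or_imp, forall_and, forall_eq, hω, hs]
      rw [and_comm]
      refine and_congr_right fun _ => ?_
      simp only [increment, Nat.add_sub_cancel]
      rcases l1 with l1 | l1 <;> rcases l2 with l2 | l2 <;> simp [l1, l2] <;> norm_num
    · have := h.stay ⟨i, hi'⟩ ⟨i + 1, hi⟩ rfl t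
      simp only [if_true]
      rw [← this]
      refine measureReal_congr ?_
      filter_upwards [ht] with ω hω
      refine propext ?_
      change (∀ m ≤ (⟨i + 1, hi⟩ : Fin n), increment η m ω = s m) ↔
        (∀ m ≤ (⟨i, hi'⟩ : Fin n), η m ω = t m) ∧ η ⟨i + 1, hi⟩ ω = η ⟨i, hi'⟩ ω
      simp only [hz, or_imp, forall_and, forall_eq, hω, hs]
      rw [and_comm]
      refine and_congr_right fun _ => ?_
      simp [increment]

variable [IsProbabilityMeasure μ]

lemma IsSymmetricChain.map_increment (h : IsSymmetricChain μ δ η) (h0 : 0 < δ) (h1 : δ < 1 / 2) :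
    μ.map (fun ω j => increment η j ω) = Measure.pi (incrementLaw δ) := by
  have := fun j : Fin n => isProbabilityMeasure_incrementLaw h0 h1 j
  have hm : Measurable fun ω j => increment η j ω := measurable_pi_lambda _ h.measurable_increment
  refine Measure.ext_of_singleton fun s => ?_
  rw [Measure.map_apply hm (measurableSet_singleton _), Measure.pi_singleton]
  simp only [incrementLaw_singleton]
  rw [← ENNReal.ofReal_prod_of_nonneg fun j _ => by split_ifs <;> linarith,
    ← ofReal_measureReal]
  congr 1
  -- The full path is the prefix ending at n - 1, which exists only for n > 0.
  rcases Nat.eq_zero_or_pos n with rfl | hn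
  · have : (fun ω j => increment η j ω) ⁻¹' {s} = Set.univ := by
      ext ω; simp [eq_iff_true_of_subsingleton]
    rw [this]; simp
  · have hlast : ∀ m : Fin n, m ≤ ⟨n - 1, by omega⟩ := fun m => by
      have := m.2; simp only [Fin.le_def]; omega
    have := h.measure_prefix s (n - 1) (by omega)
    simp only [hlast, Finset.filter_true, true_imp_iff] at this
    rw [← this]
    congr 1
    ext ω; simp [funext_iff]

lemma IsSymmetricChain.map_increment_apply (h : IsSymmetricChain μ δ η) (h0 : 0 < δ)
    (h1 : δ < 1 / 2) (j : Fin n) : μ.map (increment η j) = incrementLaw δ j := by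
  have := fun j : Fin n => isProbabilityMeasure_incrementLaw h0 h1 j
  have hm : Measurable fun ω j => increment η j ω := measurable_pi_lambda _ h.measurable_increment
  have h2 := (measurePreserving_eval (incrementLaw δ) j).map_eq
  rw [← h.map_increment h0 h1, Measure.map_map (measurable_pi_apply j) hm] at h2
  exact h2

/-- The increments of a symmetric chain are independent. -/
lemma IsSymmetricChain.iIndepFun_increment (h : IsSymmetricChain μ δ η) (h0 : 0 < δ)
    (h1 : δ < 1 / 2) : iIndepFun (increment η) μ := by
  rw [iIndepFun_iff_map_fun_eq_pi_map fun j => (h.measurable_increment j).aemeasurable]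
  simp only [h.map_increment_apply h0 h1]
  exact h.map_increment h0 h1

end

/-! ### Energy of the bucketed labels -/

section

variable {Ω : Type*} [MeasurableSpace Ω] {μ : Measure Ω} {n : ℕ} {η : Fin n → Ω → ℝ} {δ : ℝ}

/-- The sign `±1` encoded by a Boolean. -/
def boolSign (b : Bool) : ℝ := if b then 1 else -1

lemma boolSign_sq (b : Bool) : boolSign b ^ 2 = 1 := by cases b <;> simp [boolSign]

lemma IsSymmetricChain.ae_eq_prod (h : IsSymmetricChain μ δ η) :
    ∀ᵐ ω ∂μ, ∀ j : Fin n,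
      η j ω = ∏ m ∈ Finset.univ.filter (· ≤ j), boolSign (increment η m ω) := by
  filter_upwards [ae_all_iff.2 h.label] with ω hω
  rintro ⟨i, hi⟩
  induction i with
  | zero =>
    have hz : ∀ m : Fin n, m ≤ ⟨0, hi⟩ ↔ m = ⟨0, hi⟩ := fun m => by
      simp [Fin.le_def, Fin.ext_iff]
    simp only [hz, Finset.filter_eq', Finset.mem_univ, if_true, Finset.prod_singleton, increment]
    rcases hω ⟨0, hi⟩ with h1 | h1 <;> simp [h1, boolSign]
  | succ i ih =>
    have hi' : i < n := by omega
    have hfil : Finset.univ.filter (· ≤ (⟨i + 1, hi⟩ : Fin n))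
        = insert ⟨i + 1, hi⟩ (Finset.univ.filter (· ≤ (⟨i, hi'⟩ : Fin n))) := by
      ext m; simp only [Finset.mem_filter, Finset.mem_univ, true_and, Finset.mem_insert,
        Fin.le_def, Fin.ext_iff]; omega
    rw [hfil, Finset.prod_insert (by simp [Fin.le_def]), ← ih hi']
    simp only [increment, Nat.add_sub_cancel]
    rcases hω ⟨i, hi'⟩ with h1 | h1 <;> rcases hω ⟨i + 1, hi⟩ with h2 | h2 <;>
      (simp [h1, h2, boolSign]; try norm_num)

/-- The squared mean of the labels in a bucket as a function of the increments in it. -/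
def bucketEnergy (n l : ℕ) (i : Fin l) (b : bucket n l i → Bool) : ℝ :=
  ((bucketLength n l : ℝ)⁻¹ * ∑ j, ∏ m ∈ Finset.univ.filter (· ≤ j), boolSign (b m)) ^ 2

lemma bucketEnergy_restrict (l : ℕ) (i : Fin l) (b : Fin n → Bool) :
    bucketEnergy n l i (fun j => b j)
      = bucketMean l (fun j => ∏ m ∈ (bucket n l i).filter (· ≤ j), boolSign (b m)) i ^ 2 := by
  rw [bucketEnergy, bucketMean, smul_eq_mul, ← Finset.sum_coe_sort (bucket n l i)]
  refine congrArg (fun x => ((bucketLength n l : ℝ)⁻¹ * x) ^ 2)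
    (Finset.sum_congr rfl fun j _ => ?_)
  rw [Finset.prod_filter, Finset.prod_filter, ← Finset.prod_coe_sort (bucket n l i)]
  rfl

/-- All labels of a bucket share the sign `c` accumulated before it, and squaring removes it. What
remains depends on the increments inside the bucket only. -/
lemma IsSymmetricChain.ae_bucketMean_sq_eq (h : IsSymmetricChain μ δ η) (l : ℕ) (i : Fin l) :
    (fun ω => bucketMean l (fun j => η j ω) i ^ 2)
      =ᵐ[μ] fun ω => bucketEnergy n l i fun j => increment η j ω := by
  filter_upwards [h.ae_eq_prod] with ω hω
  rw [bucketEnergy_restrict l i fun j => increment η j ω]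
  set c := ∏ m ∈ Finset.univ.filter (fun m : Fin n => (m : ℕ) < i * bucketLength n l),
    boolSign (increment η m ω) with hc
  have hc2 : c ^ 2 = 1 := by
    rw [hc, ← Finset.prod_pow]; exact Finset.prod_eq_one fun m _ => boolSign_sq _
  have hη : ∀ j ∈ bucket n l i, η j ω
      = c * ∏ m ∈ (bucket n l i).filter (· ≤ j), boolSign (increment η m ω) := by
    intro j hj
    simp only [bucket, Finset.mem_filter, Finset.mem_univ, true_and] at hj
    rw [hω j, hc, ← Finset.prod_union]
    · congr 1
      ext m
      simp only [bucket, Finset.mem_filter, Finset.mem_univ, true_and, Finset.mem_union,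
        Fin.le_def]
      omega
    · rw [Finset.disjoint_left]
      intro m hm hm'
      simp only [bucket, Finset.mem_filter, Finset.mem_univ, true_and] at hm hm'
      omega
  simp only [bucketMean, smul_eq_mul]
  rw [Finset.sum_congr rfl hη, ← Finset.mul_sum]
  rw [mul_left_comm, mul_pow, hc2, one_mul]

lemma IsSymmetricChain.measurable_bucketMean_sq (h : IsSymmetricChain μ δ η) (l : ℕ) (i : Fin l) :
    Measurable fun ω => bucketMean l (fun j => η j ω) i ^ 2 := by
  have := h.measurable
  unfold bucketMean
  simp only [smul_eq_mul]
  fun_prop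

lemma IsSymmetricChain.ae_abs_le (h : IsSymmetricChain μ δ η) :
    ∀ᵐ ω ∂μ, ∀ j, |η j ω| ≤ 1 := by
  filter_upwards [ae_all_iff.2 h.label] with ω hω j
  rcases hω j with h | h <;> simp [h]

lemma IsSymmetricChain.ae_bucketMean_sq_mem (h : IsSymmetricChain μ δ η) (l : ℕ) (i : Fin l) :
    ∀ᵐ ω ∂μ, bucketMean l (fun j => η j ω) i ^ 2 ∈ Set.Icc (0 : ℝ) 1 := by
  filter_upwards [h.ae_abs_le] with ω hω
  exact ⟨sq_nonneg _, (sq_le_one_iff_abs_le_one _).2 (abs_bucketMean_le hω i)⟩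

variable [IsProbabilityMeasure μ]

/-- Disjoint buckets use disjoint sets of independent increments. The bucket means themselves need
not be independent. -/
lemma IsSymmetricChain.iIndepFun_bucketMean_sq (h : IsSymmetricChain μ δ η) (h0 : 0 < δ)
    (h1 : δ < 1 / 2) (l : ℕ) :
    iIndepFun (fun (i : Fin l) ω => bucketMean l (fun j => η j ω) i ^ 2) μ :=
  (iIndepFun_congr fun i => h.ae_bucketMean_sq_eq l i).2 <|
    iIndepFun_comp_disjoint (h.iIndepFun_increment h0 h1) h.measurable_increment (bucket n l)
      disjoint_bucket (bucketEnergy n l) fun _ => .of_discrete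

lemma IsSymmetricChain.integrable_bucketMean_sq (h : IsSymmetricChain μ δ η) (l : ℕ) (i : Fin l) :
    Integrable (fun ω => bucketMean l (fun j => η j ω) i ^ 2) μ :=
  Integrable.of_mem_Icc 0 1 (h.measurable_bucketMean_sq l i).aemeasurable
    (h.ae_bucketMean_sq_mem l i)

lemma IsSymmetricChain.expSqNorm_eq (h : IsSymmetricChain μ δ η) (l : ℕ) :
    expSqNorm μ l η = ∑ i : Fin l, ∫ ω, bucketMean l (fun j => η j ω) i ^ 2 ∂μ := by
  rw [expSqNorm, integral_finsetSum _ fun i _ => h.integrable_bucketMean_sq l i]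

/-- Concentration of the energy of the bucketed labels. -/
lemma IsSymmetricChain.measure_energy_le (h : IsSymmetricChain μ δ η) (h0 : 0 < δ)
    (h1 : δ < 1 / 2) {l : ℕ} (hl : 0 < l) (d : ℕ) :
    μ.real {ω | √((d : ℝ) / l) < |(l : ℝ)⁻¹ * ∑ i : Fin l, bucketMean l (fun j => η j ω) i ^ 2
      - expSqNorm μ l η / l|} ≤ 2 * Real.exp (-d) := by
  have hl' : (0 : ℝ) < l := by positivity
  set X : Fin l → Ω → ℝ := fun i ω => bucketMean l (fun j => η j ω) i ^ 2
    - ∫ ω, bucketMean l (fun j => η j ω) i ^ 2 ∂μ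
  have hX' : ∀ i, HasSubgaussianMGF (X i) (1 / 4) μ := fun i => by
    -- Hoeffding's lemma on [0, 1]: the variance proxies 1/4 add up to l/4, and the deviation √(dl)
    -- then has exponent 2d ≥ d.
    have := hasSubgaussianMGF_of_mem_Icc
      (h.measurable_bucketMean_sq l i).aemeasurable (h.ae_bucketMean_sq_mem l i)
    convert this using 1
    norm_num
  have hind : iIndepFun X μ :=
    (h.iIndepFun_bucketMean_sq h0 h1 l).comp
      (fun i y => y - ∫ ω, bucketMean l (fun j => η j ω) i ^ 2 ∂μ) fun i => by fun_prop
  have hsum := HasSubgaussianMGF.sum_of_iIndepFun hind (s := Finset.univ) (c := fun _ => 1 / 4)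
    fun i _ => hX' i
  have hb := measureReal_abs_gt_le hsum (ε := √(d * l)) (by positivity)
  refine (measureReal_mono ?_).trans (hb.trans ?_)
  · intro ω hω
    simp only [Set.mem_ofPred_eq, X] at hω ⊢
    rw [Finset.sum_sub_distrib, ← h.expSqNorm_eq]
    have e1 : √((d : ℝ) * l) = l * √((d : ℝ) / l) := by
      have : (d : ℝ) * l = l ^ 2 * (d / l) := by field_simp
      rw [this, Real.sqrt_mul (by positivity), Real.sqrt_sq hl'.le]
    have := mul_lt_mul_of_pos_left hω hl'
    rw [e1]
    refine this.trans_le (le_of_eq ?_)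
    rw [← abs_of_pos hl', ← abs_mul, abs_of_pos hl']
    congr 1
    field_simp
  · gcongr
    simp only [Finset.sum_const, Finset.card_univ, Fintype.card_fin, nsmul_eq_mul]
    rw [Real.sq_sqrt (by positivity)]
    push_cast
    rw [div_le_iff₀ (by positivity)]
    have : (0 : ℝ) ≤ d * l := by positivity
    linarith

/-- Without a flip inside the bucket the squared mean is 1. Only k - 1 increments matter: the one at
the first index `a` fixes the common sign. -/
lemma IsSymmetricChain.pow_le_integral_bucketMean_sq (h : IsSymmetricChain μ δ η) (h0 : 0 < δ)
    (h1 : δ < 1 / 2) {l : ℕ} (hk : 0 < bucketLength n l) (i : Fin l) :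
    (1 - δ) ^ (bucketLength n l - 1) ≤ ∫ ω, bucketMean l (fun j => η j ω) i ^ 2 ∂μ := by
  have hne : (bucket n l i).Nonempty := by rw [← Finset.card_pos, card_bucket]; exact hk
  set a := (bucket n l i).min' hne with ha
  have hamem : a ∈ bucket n l i := Finset.min'_mem _ _
  set S := (bucket n l i).erase a with hS
  have hcard : S.card = bucketLength n l - 1 := by
    rw [hS, Finset.card_erase_of_mem hamem, card_bucket]
  set G : Set Ω := ⋂ m ∈ S, increment η m ⁻¹' {true} with hG
  have hGm : MeasurableSet G := Finset.measurableSet_biInter _ fun m _ =>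
    h.measurable_increment m (measurableSet_singleton _)
  have hmarg : ∀ m ∈ S, μ (increment η m ⁻¹' {true}) = ENNReal.ofReal (1 - δ) := by
    intro m hm
    rw [← Measure.map_apply (h.measurable_increment m) (measurableSet_singleton _),
      h.map_increment_apply h0 h1, incrementLaw_singleton]
    have hm0 : (m : ℕ) ≠ 0 := by
      have h2 : a ≤ m := Finset.min'_le _ _ (Finset.mem_of_mem_erase hm)
      have h3 : m ≠ a := Finset.ne_of_mem_erase hm
      have h4 : (a : ℕ) ≤ m := h2
      have h5 : (m : ℕ) ≠ a := fun hc => h3 (Fin.ext hc)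
      omega
    simp [hm0]
  have hGμ : μ.real G = (1 - δ) ^ (bucketLength n l - 1) := by
    rw [Measure.real, hG, (h.iIndepFun_increment h0 h1).measure_inter_preimage_eq_mul S
      fun m _ => measurableSet_singleton _, Finset.prod_congr rfl hmarg, Finset.prod_const, hcard,
      ← ENNReal.ofReal_pow (by linarith), ENNReal.toReal_ofReal (pow_nonneg (by linarith) _)]
  rw [← hGμ, ← integral_indicator_one hGm]
  refine integral_mono_ae ((integrable_const (1 : ℝ)).indicator hGm)
    (h.integrable_bucketMean_sq l i) ?_
  filter_upwards [h.ae_bucketMean_sq_eq l i] with ω hω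
  rw [hω]
  by_cases hωG : ω ∈ G
  · rw [Set.indicator_of_mem hωG, bucketEnergy_restrict l i fun j => increment η j ω]
    have hprod : ∀ j ∈ bucket n l i,
        ∏ m ∈ (bucket n l i).filter (· ≤ j), boolSign (increment η m ω)
          = boolSign (increment η a ω) := by
      intro j hj
      refine Finset.prod_eq_single_of_mem a
        (Finset.mem_filter.2 ⟨hamem, Finset.min'_le _ _ hj⟩) fun m hm hne' => ?_
      have hmS : m ∈ S := Finset.mem_erase.2 ⟨hne', (Finset.mem_filter.1 hm).1⟩
      have := Set.mem_iInter₂.1 hωG m hmS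
      rw [show increment η m ω = true from this]
      simp [boolSign]
    rw [bucketMean, Finset.sum_congr rfl hprod, Finset.sum_const, card_bucket, nsmul_eq_mul,
      smul_eq_mul, ← mul_assoc, inv_mul_cancel₀ (by positivity), one_mul, boolSign_sq]
    rfl
  · rw [Set.indicator_of_notMem hωG]
    exact sq_nonneg _

/-- The expected energy of the labels is of constant order if the buckets are short. -/
lemma IsSymmetricChain.exp_neg_two_le_expSqNorm_div (h : IsSymmetricChain μ δ η) (h0 : 0 < δ)
    (h1 : δ < 1 / 2) {l : ℕ} (hl : 0 < l) (hk : 0 < bucketLength n l)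
    (hkδ : bucketLength n l * δ ≤ 1) : Real.exp (-2) ≤ expSqNorm μ l η / l := by
  have hl' : (0 : ℝ) < l := by positivity
  have hpow : Real.exp (-2) ≤ (1 - δ) ^ (bucketLength n l - 1) := by
    -- Valid because δ < 1/2; raised to a power at most k it gives e^{-2kδ} ≥ e^{-2}.
    have h2 : Real.exp (-(2 * δ)) ≤ 1 - δ := by
      rw [← Real.le_log_iff_exp_le (by linarith)]
      refine le_trans ?_ (Real.one_sub_inv_le_log_of_pos (by linarith))
      have : (1 - δ)⁻¹ ≤ 1 + 2 * δ := by
        rw [inv_le_iff_one_le_mul₀ (by linarith)]; nlinarith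
      linarith
    calc Real.exp (-2) ≤ Real.exp (-(2 * δ)) ^ (bucketLength n l - 1) := by
          rw [← Real.exp_nat_mul, Real.exp_le_exp]
          have : ((bucketLength n l - 1 : ℕ) : ℝ) ≤ bucketLength n l := by
            exact_mod_cast Nat.sub_le _ _
          nlinarith
      _ ≤ _ := by gcongr
  rw [le_div_iff₀ hl', h.expSqNorm_eq]
  calc Real.exp (-2) * l = ∑ _i : Fin l, Real.exp (-2) := by
        rw [Finset.sum_const, Finset.card_univ, Fintype.card_fin, nsmul_eq_mul, mul_comm]
    _ ≤ _ := Finset.sum_le_sum fun i _ =>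
        hpow.trans (h.pow_le_integral_bucketMean_sq h0 h1 hk i)

/-- With one label per bucket every square is 1. This removes the label fluctuation when ‖θ‖ is
arbitrarily large. -/
lemma IsSymmetricChain.ae_energy_eq_of_bucketLength_eq_one (h : IsSymmetricChain μ δ η) {l : ℕ}
    (hk : bucketLength n l = 1) :
    ∀ᵐ ω ∂μ, ∑ i : Fin l, bucketMean l (fun j => η j ω) i ^ 2 = expSqNorm μ l η := by
  have hae : ∀ᵐ ω ∂μ, ∀ i : Fin l, bucketMean l (fun j => η j ω) i ^ 2 = 1 := by
    filter_upwards [ae_all_iff.2 h.label] with ω hω i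
    obtain ⟨j, hj⟩ := Finset.card_eq_one.1 ((card_bucket (n := n) i).trans hk)
    rw [bucketMean, hk, hj]
    rcases hω j with h | h <;> simp [h]
  have hE : expSqNorm μ l η = l := by
    rw [expSqNorm, integral_congr_ae (g := fun _ => (l : ℝ))
      (by filter_upwards [hae] with ω hω; simp [hω])]
    simp
  filter_upwards [hae] with ω hω
  rw [hE]; simp [hω]

end

/-! ### From the sample covariance to the loss -/

section

variable {n d : ℕ}

lemma sampleCov_isSymm (l : ℕ) (Y : Fin n → EuclideanSpace ℝ (Fin d)) :
    (sampleCov l Y).IsSymm := by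
  rw [Matrix.IsSymm, sampleCov, Matrix.transpose_smul, Matrix.transpose_mul,
    Matrix.transpose_transpose]

/-- The matrix λmax I - A is symmetric with nonnegative spectrum, hence positive semidefinite; the
spectrum is finite, so the supremum does bound it. -/
lemma dotProduct_mulVec_le_lambdaMax {A : Matrix (Fin d) (Fin d) ℝ} (hA : A.IsSymm)
    (x : EuclideanSpace ℝ (Fin d)) :
    x.ofLp ⬝ᵥ A.mulVec x.ofLp ≤ lambdaMax A * ‖x‖ ^ 2 := by
  have hH : A.IsHermitian := by
    rw [Matrix.IsHermitian, Matrix.conjTranspose_eq_transpose_of_trivial]; exact hA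
  have hpsd : (algebraMap ℝ (Matrix (Fin d) (Fin d) ℝ) (lambdaMax A) - A).PosSemidef := by
    rw [Matrix.posSemidef_iff_isHermitian_and_spectrum_nonneg]
    refine ⟨Matrix.IsHermitian.sub ?_ hH, ?_⟩
    · rw [Matrix.IsHermitian, Matrix.conjTranspose_eq_transpose_of_trivial,
        Matrix.algebraMap_eq_diagonal, Matrix.diagonal_transpose]
    · rw [← spectrum.singleton_sub_eq]
      rintro _ ⟨a, rfl, b, hb, rfl⟩
      have : b ≤ lambdaMax A := le_csSup A.finite_real_spectrum.bddAbove hb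
      simpa using this
  have := hpsd.dotProduct_mulVec_nonneg x.ofLp
  rw [star_trivial, Matrix.sub_mulVec, dotProduct_sub, Algebra.algebraMap_eq_smul_one,
    Matrix.smul_mulVec, Matrix.one_mulVec, dotProduct_smul, smul_eq_mul] at this
  have hx : x.ofLp ⬝ᵥ x.ofLp = ‖x‖ ^ 2 := by
    rw [EuclideanSpace.real_norm_sq_eq]; simp [dotProduct, sq]
  rw [hx] at this
  linarith

lemma dotProduct_eq_inner (x y : EuclideanSpace ℝ (Fin d)) : x.ofLp ⬝ᵥ y.ofLp = inner ℝ x y := by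
  rw [real_inner_comm, EuclideanSpace.inner_eq_star_dotProduct, star_trivial]

lemma dotProduct_sampleCov_mulVec (l : ℕ) (Y : Fin n → EuclideanSpace ℝ (Fin d))
    (x y : EuclideanSpace ℝ (Fin d)) :
    x.ofLp ⬝ᵥ (sampleCov l Y).mulVec y.ofLp
      = (l : ℝ)⁻¹ * ∑ i : Fin l, inner ℝ x (bucketMean l Y i) * inner ℝ y (bucketMean l Y i) := by
  rw [sampleCov, Matrix.smul_mulVec, dotProduct_smul, smul_eq_mul, ← Matrix.mulVec_mulVec,
    Matrix.dotProduct_mulVec, Matrix.mulVec_transpose]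
  congr 1
  refine Finset.sum_congr rfl fun i _ => ?_
  rw [← dotProduct_eq_inner, ← dotProduct_eq_inner]
  rfl

/-- Signal, cross and noise parts of the centred sample covariance. -/
lemma sampleCov_decomposition {l : ℕ} (h : Fin n → ℝ) (z : Fin n → EuclideanSpace ℝ (Fin d))
    (θ x y : EuclideanSpace ℝ (Fin d)) (Y : Fin n → EuclideanSpace ℝ (Fin d))
    (hY : ∀ i : Fin l, bucketMean l Y i = bucketMean l h i • θ + bucketMean l z i) :
    x.ofLp ⬝ᵥ (sampleCov l Y).mulVec y.ofLp - (bucketLength n l : ℝ)⁻¹ * inner ℝ x y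
      = (l : ℝ)⁻¹ * (∑ i : Fin l, bucketMean l h i ^ 2) * (inner ℝ θ x * inner ℝ θ y)
        + (inner ℝ θ x * inner ℝ y (crossVec l h z) + inner ℝ x (crossVec l h z) * inner ℝ θ y)
        + noiseForm l z x y := by
  rw [dotProduct_sampleCov_mulVec, noiseForm_apply]
  simp only [hY, crossVec, inner_add_right, inner_smul_right, inner_sum, real_inner_comm θ,
    Finset.mul_sum, Finset.sum_mul, ← Finset.sum_add_distrib]
  rw [sub_eq_iff_eq_add, add_assoc, sub_add_cancel, ← Finset.sum_add_distrib]
  refine Finset.sum_congr rfl fun i _ => ?_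
  ring

/-- Deterministic error bound of the spectral estimator in terms of the deviations of the label
energy, of the cross term, and of the noise covariance. -/
lemma loss_thetaHat_sq_le {l : ℕ} {E g w U : ℝ}
    {vmax : Matrix (Fin d) (Fin d) ℝ → EuclideanSpace ℝ (Fin d)} (hv : IsTopEigenvectorMap vmax)
    (h : Fin n → ℝ) (z : Fin n → EuclideanSpace ℝ (Fin d))
    (θ : EuclideanSpace ℝ (Fin d)) (Y : Fin n → EuclideanSpace ℝ (Fin d))
    (hY : ∀ i : Fin l, bucketMean l Y i = bucketMean l h i • θ + bucketMean l z i)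
    (hE : Real.exp (-2) ≤ E / l)
    (hg : |(l : ℝ)⁻¹ * ∑ i : Fin l, bucketMean l h i ^ 2 - E / l| ≤ g)
    (hU : ‖crossVec l h z‖ ≤ U)
    (hw : ∀ x y, |noiseForm l z x y| ≤ w * ‖x‖ * ‖y‖) (hw0 : 0 ≤ w) :
    loss (thetaHat vmax l E Y) θ ^ 2 ≤ 24 * (g * ‖θ‖ ^ 2 + 2 * ‖θ‖ * U + w) ∧
    loss (thetaHat vmax l E Y) θ ^ 2 * ‖θ‖ ^ 2
      ≤ 768 * (g * ‖θ‖ ^ 2 + 2 * ‖θ‖ * U + w) ^ 2 := by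
  set a := E / l with ha
  have ha0 : 0 < a := (Real.exp_pos _).trans_le hE
  -- From a ≥ e^{-2}. The perturbation constants 3 and 12 become 24 = 3 · 8 and 768 = 12 · 8².
  have hai : a⁻¹ ≤ 8 := by
    have h1 := Real.exp_one_lt_d9
    have h2 : Real.exp 2 = Real.exp 1 ^ 2 := by rw [← Real.exp_nat_mul]; norm_num
    calc a⁻¹ ≤ (Real.exp (-2))⁻¹ := by gcongr
      _ = Real.exp 1 ^ 2 := by rw [Real.exp_neg, inv_inv, h2]
      _ ≤ 2.8 ^ 2 := by gcongr; linarith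
      _ ≤ 8 := by norm_num
  set S := sampleCov l Y with hS
  set u := crossVec l h z with hu
  obtain ⟨hv1, hv2⟩ := hv S (sampleCov_isSymm l Y)
  set v := vmax S with hvdef
  set m := lambdaMax S - 1 / (bucketLength n l : ℝ) with hm
  set A := (l : ℝ)⁻¹ * ∑ i : Fin l, bucketMean l h i ^ 2 with hA
  have hg0 : 0 ≤ g := (abs_nonneg _).trans hg
  have hU0 : 0 ≤ U := (norm_nonneg _).trans hU
  set q := g * ‖θ‖ ^ 2 + 2 * ‖θ‖ * U + w with hq
  have hq0 : 0 ≤ q := by positivity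
  have hbil : ∀ x y : EuclideanSpace ℝ (Fin d), |(A - a) * (inner ℝ θ x * inner ℝ θ y)
      + (inner ℝ θ x * inner ℝ y u + inner ℝ x u * inner ℝ θ y)
      + noiseForm l z x y| ≤ q * ‖x‖ * ‖y‖ := by
    intro x y
    have c1 := abs_real_inner_le_norm θ x
    have c2 := abs_real_inner_le_norm θ y
    have c3 := (abs_real_inner_le_norm y u).trans (mul_le_mul_of_nonneg_left hU (norm_nonneg _))
    have c4 := (abs_real_inner_le_norm x u).trans (mul_le_mul_of_nonneg_left hU (norm_nonneg _))
    have c5 := hw x y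
    have d1 : |(A - a) * (inner ℝ θ x * inner ℝ θ y)| ≤ g * (‖θ‖ * ‖x‖ * (‖θ‖ * ‖y‖)) := by
      rw [abs_mul, abs_mul]; gcongr
    have d2 : |inner ℝ θ x * inner ℝ y u| ≤ ‖θ‖ * ‖x‖ * (‖y‖ * U) := by
      rw [abs_mul]; gcongr
    have d3 : |inner ℝ x u * inner ℝ θ y| ≤ ‖x‖ * U * (‖θ‖ * ‖y‖) := by
      rw [abs_mul]; gcongr
    refine (abs_add_le _ _).trans ?_
    refine (add_le_add (abs_add_le _ _) le_rfl).trans ?_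
    refine (add_le_add (add_le_add le_rfl (abs_add_le _ _)) le_rfl).trans ?_
    rw [hq]
    linarith
  have hdec := fun x y => sampleCov_decomposition (l := l) h z θ x y Y hY
  have hx1 : ∀ x, |m / a * inner ℝ x v - inner ℝ θ x * inner ℝ θ v| ≤ q / a * ‖x‖ := by
    intro x
    have e1 := hdec x v
    rw [← hS, hv2, dotProduct_smul, dotProduct_eq_inner, smul_eq_mul] at e1
    have e2 := hbil x v
    rw [hv1, mul_one] at e2
    have e3 : m / a * inner ℝ x v - inner ℝ θ x * inner ℝ θ v
        = a⁻¹ * ((A - a) * (inner ℝ θ x * inner ℝ θ v)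
          + (inner ℝ θ x * inner ℝ v u + inner ℝ x u * inner ℝ θ v) + noiseForm l z x v) := by
      have : m * inner ℝ x v = A * (inner ℝ θ x * inner ℝ θ v)
          + (inner ℝ θ x * inner ℝ v u + inner ℝ x u * inner ℝ θ v) + noiseForm l z x v := by
        rw [← e1, hm]; ring
      rw [div_mul_eq_mul_div, this]
      field_simp
      ring
    rw [e3, abs_mul, abs_of_pos (inv_pos.2 ha0)]
    calc a⁻¹ * _ ≤ a⁻¹ * (q * ‖x‖) := by gcongr
      _ = q / a * ‖x‖ := by ring
  -- The Rayleigh quotient at θ bounds the top eigenvalue from below. For θ = 0 the approximate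
  -- eigenvector relation at v suffices.
  have hx2 : ‖θ‖ ^ 2 - q / a ≤ m / a := by
    rcases eq_or_ne θ 0 with rfl | hθ
    · have := hx1 v
      rw [real_inner_self_eq_norm_sq, hv1] at this
      simp only [inner_zero_left, mul_zero, sub_zero, one_pow, mul_one] at this
      have := neg_le_of_abs_le this
      simpa using this
    · have hT : 0 < ‖θ‖ ^ 2 := by positivity
      have e1 := hdec θ θ
      have e2 := dotProduct_mulVec_le_lambdaMax (sampleCov_isSymm l Y) θ
      have e3 := (abs_le.1 (hbil θ θ)).1
      rw [real_inner_self_eq_norm_sq] at e1 e3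
      have e4 : (a * ‖θ‖ ^ 2 - q) * ‖θ‖ ^ 2 ≤ m * ‖θ‖ ^ 2 := by
        rw [hm, one_div]
        have e5 : q * ‖θ‖ * ‖θ‖ = q * ‖θ‖ ^ 2 := by ring
        linarith
      have e6 := le_of_mul_le_mul_right e4 hT
      rw [← div_le_div_iff_of_pos_right ha0] at e6
      refine le_trans (le_of_eq ?_) e6
      field_simp
  have hqa : q / a ≤ 8 * q := by rw [div_eq_mul_inv, mul_comm]; gcongr
  have hqa0 : 0 ≤ q / a := by positivity
  obtain ⟨r1, r2⟩ := loss_sq_le_of_perturbation hv1 hqa0 hx1 hx2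
  have hhat : thetaHat vmax l E Y = √(max (m / a) 0) • v := by
    rw [thetaHat]
    congr 2
    rw [← hS, ← hm, ha]
    have : (l : ℝ) / E = a⁻¹ := by rw [ha, inv_div]
    rw [this, mul_max_of_nonneg _ _ (inv_pos.2 ha0).le, mul_zero, ha]
    congr 1
    ring
  rw [hhat]
  refine ⟨r1.trans (by linarith), r2.trans ?_⟩
  have := pow_le_pow_left₀ hqa0 hqa 2
  rw [mul_pow] at this
  linarith

end

/-! ### The choice of ℓ* and the three rates -/

section

/-- From n < l(k + 1) and k ≥ 1: discarding the leftover observations costs at most a factor 2. -/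
lemma le_two_mul_mul_bucketLength {n l : ℕ} (hl : 0 < l) (hln : l ≤ n) :
    (n : ℝ) ≤ 2 * (l * bucketLength n l) := by
  have h1 : n < l * (bucketLength n l + 1) := Nat.lt_mul_div_succ n hl
  have h2 := bucketLength_pos hl hln
  have h3 : l * 1 ≤ l * bucketLength n l := Nat.mul_le_mul_left _ h2
  have : n ≤ 2 * (l * bucketLength n l) := by rw [mul_add] at h1; omega
  exact_mod_cast this

/-- Size of the total perturbation in terms of a common scale `ρ` of its three parts. -/
lemma perturbation_le {n d l : ℕ} (hl : 0 < l) (hln : l ≤ n) {t g ρ : ℝ}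
    (hρ : 0 ≤ ρ) (hg : g * t ^ 2 ≤ ρ) (h1 : t ^ 2 * (d / n) ≤ ρ ^ 2)
    (h2 : (d : ℝ) / n * (l / n) ≤ 4 * ρ ^ 2) :
    g * t ^ 2 + 2 * t * (6 * √((d : ℝ) / (l * bucketLength n l)))
      + 1664 * ((bucketLength n l : ℝ)⁻¹ * √((d : ℝ) / l)) ≤ 6681 * ρ := by
  have hk := bucketLength_pos hl hln
  have hlk := le_two_mul_mul_bucketLength hl hln
  have hl' : (0 : ℝ) < l := by positivity
  have hk' : (0 : ℝ) < bucketLength n l := by positivity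
  have hn' : (0 : ℝ) < n := by have : 0 < n := by omega
                               positivity
  set k := (bucketLength n l : ℝ)
  have a1 : t * √((d : ℝ) / (l * k)) ≤ 2 * ρ := by
    refine abs_le_of_sq_le_sq' ?_ (by positivity) |>.2
    rw [mul_pow, Real.sq_sqrt (by positivity)]
    have : (d : ℝ) / (l * k) ≤ 2 * (d / n) := by
      rw [div_le_iff₀ (by positivity), mul_assoc, div_mul_eq_mul_div, mul_div_assoc',
        le_div_iff₀ hn']
      nlinarith [mul_le_mul_of_nonneg_left hlk (Nat.cast_nonneg (α := ℝ) d)]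
    nlinarith [mul_le_mul_of_nonneg_left this (sq_nonneg t)]
  have a2 : k⁻¹ * √((d : ℝ) / l) ≤ 4 * ρ := by
    refine abs_le_of_sq_le_sq' ?_ (by positivity) |>.2
    rw [mul_pow, Real.sq_sqrt (by positivity)]
    have hki : k⁻¹ ≤ 2 * (l / n) := by
      rw [inv_le_iff_one_le_mul₀ hk', mul_assoc, div_mul_eq_mul_div, mul_div_assoc',
        le_div_iff₀ hn', one_mul]
      exact hlk
    calc k⁻¹ ^ 2 * ((d : ℝ) / l) ≤ (2 * ((l : ℝ) / n)) ^ 2 * ((d : ℝ) / l) := by gcongr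
      _ = 4 * ((d : ℝ) / n * (l / n)) := by field_simp; ring
      _ ≤ (4 * ρ) ^ 2 := by linarith
  -- The total is 6681 = 1 + 12 · 2 + 1664 · 4.
  linarith

variable {n d : ℕ} {δ : ℝ} {θ : EuclideanSpace ℝ (Fin d)}

lemma ellStar_le (hdn : d ≤ n) : ellStar n δ θ ≤ n := max_le hdn (min_le_right _ _)

lemma le_ellStar : d ≤ ellStar n δ θ := le_max_left _ _

/-- The truncation at 1 reflects the cap ℓ* ≤ n and is inactive for δ and for ‖θ‖² ≤ 1. -/
lemma mul_min_le_ellStar : (n : ℝ) * min (max δ (‖θ‖ ^ 2)) 1 ≤ ellStar n δ θ := by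
  rw [ellStar, Nat.cast_max, Nat.cast_min]
  refine le_max_of_le_right (le_min ?_ ?_)
  · exact (mul_le_mul_of_nonneg_left (min_le_left _ _) (Nat.cast_nonneg _)).trans (Nat.le_ceil _)
  · exact (mul_le_mul_of_nonneg_left (min_le_right _ _) (Nat.cast_nonneg _)).trans (by simp)

lemma ellStar_div_le (hd : 1 ≤ d) (hn : 1 ≤ n) (h0 : 0 < δ) :
    (ellStar n δ θ : ℝ) / n ≤ 2 * (d / n) + (δ + ‖θ‖ ^ 2) := by
  have hn' : (0 : ℝ) < n := by positivity
  have hd' : (1 : ℝ) ≤ d := by exact_mod_cast hd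
  have hT := sq_nonneg ‖θ‖
  have hmax : max δ (‖θ‖ ^ 2) ≤ δ + ‖θ‖ ^ 2 := max_le (by linarith) (by linarith)
  have h1 : (ellStar n δ θ : ℝ) ≤ 2 * d + n * (δ + ‖θ‖ ^ 2) := by
    rw [ellStar, Nat.cast_max, Nat.cast_min]
    refine max_le (by nlinarith [mul_nonneg hn'.le (add_nonneg h0.le hT)])
      ((min_le_left _ _).trans ?_)
    -- Rounding up adds at most 1 ≤ d, absorbed in 2d.
    have := (Nat.ceil_lt_add_one (a := (n : ℝ) * max δ (‖θ‖ ^ 2)) (by positivity)).le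
    have := mul_le_mul_of_nonneg_left hmax hn'.le
    linarith
  rw [div_le_iff₀ hn']
  calc _ ≤ _ := h1
    _ = _ := by field_simp

/-- If `ℓ* < n`, then `ℓ* ≥ n (δ ∨ ‖θ‖²)`. -/
lemma mul_max_le_ellStar_of_lt (h : ellStar n δ θ < n) :
    (n : ℝ) * max δ (‖θ‖ ^ 2) ≤ ellStar n δ θ := by
  refine (Nat.le_ceil _).trans ?_
  have h1 : min ⌈(n : ℝ) * max δ (‖θ‖ ^ 2)⌉₊ n ≤ ellStar n δ θ := le_max_right _ _
  rcases min_choice ⌈(n : ℝ) * max δ (‖θ‖ ^ 2)⌉₊ n with h2 | h2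
  · rw [h2] at h1; exact_mod_cast h1
  · rw [h2] at h1; omega

/-- The error of the oracle estimator off an event of exponentially small probability. -/
lemma IsModel.exists_bad_event {Ω : Type*} [MeasurableSpace Ω] {μ : Measure Ω}
    [IsProbabilityMeasure μ] {η : Fin n → Ω → ℝ} {ξ : Fin n → Ω → EuclideanSpace ℝ (Fin d)}
    (hM : IsModel μ δ η ξ) (hd : 1 ≤ d) (hdn : d ≤ n) (h0 : 0 < δ) (h1 : δ < 1 / 2)
    {vmax : Matrix (Fin d) (Fin d) ℝ → EuclideanSpace ℝ (Fin d)} (hv : IsTopEigenvectorMap vmax)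
    (θ : EuclideanSpace ℝ (Fin d)) :
    ∃ bad : Set Ω, μ bad ≤ ENNReal.ofReal (8 * Real.exp (-d)) ∧ ∀ ω ∉ bad, ∃ g : ℝ,
      g ≤ √((d : ℝ) / ellStar n δ θ) ∧ (bucketLength n (ellStar n δ θ) = 1 → g ≤ 0) ∧
      ∀ ρ : ℝ, 0 ≤ ρ → g * ‖θ‖ ^ 2 ≤ ρ → ‖θ‖ ^ 2 * (d / n) ≤ ρ ^ 2 →
        (d : ℝ) / n * (ellStar n δ θ / n) ≤ 4 * ρ ^ 2 →
        loss (oracle μ δ η ξ vmax θ ω) θ ^ 2 ≤ 24 * (6681 * ρ) ∧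
        loss (oracle μ δ η ξ vmax θ ω) θ ^ 2 * ‖θ‖ ^ 2 ≤ 768 * (6681 * ρ) ^ 2 := by
  set l := ellStar n δ θ with hl_def
  have hdl : d ≤ l := le_ellStar
  have hl : 0 < l := by omega
  have hln : l ≤ n := ellStar_le hdn
  have hl' : (0 : ℝ) < l := by positivity
  have hn' : (0 : ℝ) < n := by have : 0 < n := by omega
                               positivity
  have hk := bucketLength_pos hl hln
  have hkδ : bucketLength n l * δ ≤ 1 := by
    have e1 : (bucketLength n l : ℝ) ≤ n / l := Nat.cast_div_le
    have e2 : (n : ℝ) * δ ≤ l := by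
      refine le_trans ?_ (mul_min_le_ellStar (θ := θ))
      gcongr
      exact le_min (le_max_left _ _) (by linarith)
    calc (bucketLength n l : ℝ) * δ ≤ n / l * δ := by gcongr
      _ = n * δ / l := by ring
      _ ≤ 1 := by rw [div_le_one hl']; exact e2
  have hE := hM.chain.exp_neg_two_le_expSqNorm_div h0 h1 hl hk hkδ
  let Aω : Ω → ℝ := fun ω => |(l : ℝ)⁻¹ * ∑ i : Fin l, bucketMean l (fun j => η j ω) i ^ 2
    - expSqNorm μ l η / l|
  let B1 : Set Ω := {ω | √((d : ℝ) / l) < Aω ω}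
  let B2 : Set Ω := {ω | 6 * √((d : ℝ) / (l * bucketLength n l))
      < ‖crossVec l (fun j => η j ω) fun j => ξ j ω‖}
  let B3 : Set Ω := {ω | ¬ ∀ x y, |noiseForm l (fun j => ξ j ω) x y|
      ≤ 1664 * ((bucketLength n l : ℝ)⁻¹ * √((d : ℝ) / l)) * ‖x‖ * ‖y‖}
  let B4 : Set Ω := {ω | ¬ (bucketLength n l = 1 →
    ∑ i : Fin l, bucketMean l (fun j => η j ω) i ^ 2 = expSqNorm μ l η)}
  have p1 : μ B1 ≤ ENNReal.ofReal (2 * Real.exp (-d)) := by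
    rw [← ofReal_measureReal]
    exact ENNReal.ofReal_le_ofReal (hM.chain.measure_energy_le h0 h1 hl d)
  have p2 : μ B2 ≤ ENNReal.ofReal (2 * Real.exp (-d)) := hM.measure_norm_crossVec_le hl hln
  have p3 : μ B3 ≤ ENNReal.ofReal (4 * Real.exp (-d)) := by
    rw [← ofReal_measureReal]
    exact ENNReal.ofReal_le_ofReal (hM.noise.measure_noiseForm_le hl hdl hln)
  have p4 : μ B4 = 0 := by
    by_cases hk1 : bucketLength n l = 1
    · have := hM.chain.ae_energy_eq_of_bucketLength_eq_one hk1
      rw [ae_iff] at this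
      simpa [B4, hk1] using this
    · simp [B4, hk1]
  refine ⟨B1 ∪ B2 ∪ B3 ∪ B4, ?_, ?_⟩
  · have hpos := (Real.exp_pos (-(d : ℝ))).le
    calc μ (B1 ∪ B2 ∪ B3 ∪ B4) ≤ μ B1 + μ B2 + μ B3 + μ B4 :=
          (measure_union_le _ _).trans (add_le_add_left ((measure_union_le _ _).trans
            (add_le_add_left (measure_union_le _ _) _)) _)
      _ ≤ ENNReal.ofReal (2 * Real.exp (-d)) + ENNReal.ofReal (2 * Real.exp (-d))
          + ENNReal.ofReal (4 * Real.exp (-d)) + 0 := by rw [p4]; gcongr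
      _ = ENNReal.ofReal (8 * Real.exp (-d)) := by
          rw [add_zero, ← ENNReal.ofReal_add (by positivity) (by positivity),
            ← ENNReal.ofReal_add (by positivity) (by positivity)]
          congr 1; ring
  · intro ω hω
    simp only [Set.mem_union, not_or] at hω
    obtain ⟨⟨⟨w1, w2⟩, w3⟩, w4⟩ := hω
    simp only [B1, B2, B3, B4, Set.mem_ofPred_eq, not_lt, not_not] at w1 w2 w3 w4
    refine ⟨Aω ω, w1, fun hk1 => ?_, fun ρ hρ hg hT hL => ?_⟩
    · simp only [Aω, w4 hk1]
      rw [inv_mul_eq_div, sub_self, abs_zero]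
    · obtain ⟨r1, r2⟩ := loss_thetaHat_sq_le hv (fun j => η j ω) (fun j => ξ j ω) θ
        (obs η ξ θ ω) (fun i => bucketMean_obs η ξ θ ω l i) hE (le_refl (Aω ω)) w2 w3
        (by positivity)
      have hq := perturbation_le hl hln hρ hg hT hL
      have hA0 : 0 ≤ Aω ω := abs_nonneg _
      refine ⟨r1.trans (by gcongr), r2.trans (by gcongr)⟩

/-- The three regimes of the error off an event of exponentially small probability. -/
lemma IsModel.exists_bad_event_rates {Ω : Type*} [MeasurableSpace Ω] {μ : Measure Ω}
    [IsProbabilityMeasure μ] {η : Fin n → Ω → ℝ} {ξ : Fin n → Ω → EuclideanSpace ℝ (Fin d)}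
    (hM : IsModel μ δ η ξ) (hd : 1 ≤ d) (hdn : d ≤ n) (h0 : 0 < δ) (h1 : δ < 1 / 2)
    {vmax : Matrix (Fin d) (Fin d) ℝ → EuclideanSpace ℝ (Fin d)} (hv : IsTopEigenvectorMap vmax)
    (θ : EuclideanSpace ℝ (Fin d)) :
    ∃ bad : Set Ω, μ bad ≤ ENNReal.ofReal (8 * Real.exp (-d)) ∧ ∀ ω ∉ bad,
      (‖θ‖ ^ 2 ≤ max (√(δ * d / n)) ((d : ℝ) / n) →
        loss (oracle μ δ η ξ vmax θ ω) θ ^ 2 ≤ 40000000000 * (√(δ * d / n) + (d : ℝ) / n)) ∧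
      ((d : ℝ) / n ≤ δ → max (√(δ * d / n)) ((d : ℝ) / n) ≤ ‖θ‖ ^ 2 →
        ‖θ‖ ^ 2 ≤ max δ ((d : ℝ) / n) →
        loss (oracle μ δ η ξ vmax θ ω) θ ^ 2 ≤ 40000000000 * (δ * d / n / ‖θ‖ ^ 2)) ∧
      (max δ ((d : ℝ) / n) ≤ ‖θ‖ ^ 2 →
        loss (oracle μ δ η ξ vmax θ ω) θ ^ 2 ≤ 40000000000 * ((d : ℝ) / n)) := by
  obtain ⟨bad, hbad, hgood⟩ := hM.exists_bad_event hd hdn h0 h1 hv θ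
  refine ⟨bad, hbad, fun ω hω => ?_⟩
  obtain ⟨g, hg, hg1, hmain⟩ := hgood ω hω
  have hn : 1 ≤ n := hd.trans hdn
  have hn' : (0 : ℝ) < n := by positivity
  have hd' : (0 : ℝ) < d := by positivity
  set l := ellStar n δ θ with hl_def
  have hdl : d ≤ l := le_ellStar
  have hl : 0 < l := by omega
  have hln : l ≤ n := ellStar_le hdn
  have hl' : (0 : ℝ) < l := by positivity
  have hL := ellStar_div_le (θ := θ) hd hn h0
  have hmin := mul_min_le_ellStar (n := n) (δ := δ) (θ := θ)
  rw [← hl_def] at hL hmin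
  set x := loss (oracle μ δ η ξ vmax θ ω) θ ^ 2
  set T := ‖θ‖ ^ 2 with hT
  have hT0 : 0 ≤ T := sq_nonneg _
  set D := (d : ℝ) / n with hD
  have hD0 : 0 < D := by positivity
  rw [mul_div_assoc δ, ← hD]
  have hsq : √(δ * D) ^ 2 = δ * D := Real.sq_sqrt (by positivity)
  have hs0 := Real.sqrt_nonneg (δ * D)
  have hg_one : g ≤ 1 := by
    refine hg.trans (Real.sqrt_le_one.2 ?_)
    rw [div_le_one hl']; exact_mod_cast hdl
  refine ⟨fun hreg => ?_, fun hDδ hlow hup => ?_, fun hreg => ?_⟩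
  -- Weak signal: ρ = R. Here g ≤ 1 suffices, as ‖θ‖² ≤ R. The factor 4 in `b2` is 2 + 1 + 1, from
  -- ℓ*/n ≤ 2D + δ + T.
  · set R := √(δ * D) + D with hR
    have hTR : T ≤ R := hreg.trans (max_le (by linarith) (by linarith))
    have hR0 : 0 < R := by positivity
    have hDR : D ≤ R := by linarith
    have hδR : D * δ ≤ R ^ 2 := by nlinarith
    have b1 : T * D ≤ R ^ 2 := by rw [sq]; gcongr
    have b2 : D * (l / n) ≤ 4 * R ^ 2 := by
      have c1 := mul_le_mul_of_nonneg_left hL hD0.le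
      have c2 : D * D ≤ R ^ 2 := by rw [sq]; gcongr
      linarith
    have := (hmain R hR0.le (by nlinarith) b1 b2).1
    linarith
  · rw [max_eq_left hDδ] at hup
    have hDT : D ≤ T := (le_max_right _ _).trans hlow
    have hTpos : 0 < T := hD0.trans_le hDT
    have hδl : δ ≤ l / n := by
      rw [le_div_iff₀ hn', mul_comm]
      refine le_trans ?_ hmin
      gcongr
      exact le_min (le_max_left _ _) (by linarith)
    -- Middle regime: ρ = √(δD). Since ℓ* ≥ nδ and T ≤ δ, (d/ℓ*)T² ≤ (D/δ)δ².
    have b0 : g * T ≤ √(δ * D) := by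
      refine (mul_le_mul_of_nonneg_right hg hT0).trans ?_
      refine abs_le_of_sq_le_sq' ?_ hs0 |>.2
      rw [mul_pow, hsq, Real.sq_sqrt (by positivity)]
      have c1 : (d : ℝ) / l ≤ D / δ := by
        rw [div_le_div_iff₀ hl' h0, hD, div_mul_eq_mul_div, le_div_iff₀ hn']
        rw [le_div_iff₀ hn'] at hδl
        nlinarith
      calc (d : ℝ) / l * T ^ 2 ≤ D / δ * δ ^ 2 := by gcongr
        _ = δ * D := by field_simp
    have b1 : T * D ≤ √(δ * D) ^ 2 := by rw [hsq]; gcongr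
    have b2 : D * (l / n) ≤ 4 * √(δ * D) ^ 2 := by
      rw [hsq]
      have c1 := mul_le_mul_of_nonneg_left hL hD0.le
      have c2 : D * D ≤ δ * D := by gcongr
      linarith
    have := (hmain _ hs0 b0 b1 b2).2
    rw [mul_pow, hsq] at this
    rw [← mul_div_assoc, le_div_iff₀ hTpos]
    have : 0 < δ * D := by positivity
    linarith
  · have hδT : δ ≤ T := (le_max_left _ _).trans hreg
    have hDT : D ≤ T := (le_max_right _ _).trans hreg
    have hTpos : 0 < T := hD0.trans_le hDT
    have hsq' : √(D * T) ^ 2 = D * T := Real.sq_sqrt (by positivity)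
    -- Strong signal: ρ = √(DT). If k ≠ 1 then ℓ* < n, so ℓ* ≥ nT and (d/ℓ*)T² ≤ DT. If k = 1, g ≤ 0
    -- covers unbounded T.
    have b0 : g * T ≤ √(D * T) := by
      by_cases hk1 : bucketLength n l = 1
      · exact (mul_nonpos_of_nonpos_of_nonneg (hg1 hk1) hT0).trans (Real.sqrt_nonneg _)
      · have hlt : l < n := by
          refine lt_of_le_of_ne hln fun hc => hk1 ?_
          rw [bucketLength, hc, Nat.div_self (by omega)]
        have hTl := mul_max_le_ellStar_of_lt (θ := θ) (δ := δ) hlt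
        rw [← hl_def, ← hT, max_eq_right hδT] at hTl
        refine (mul_le_mul_of_nonneg_right hg hT0).trans ?_
        refine abs_le_of_sq_le_sq' ?_ (Real.sqrt_nonneg _) |>.2
        rw [mul_pow, hsq', Real.sq_sqrt (by positivity)]
        have c1 : (d : ℝ) / l ≤ D / T := by
          rw [div_le_div_iff₀ hl' hTpos, hD, div_mul_eq_mul_div, le_div_iff₀ hn']
          nlinarith
        calc (d : ℝ) / l * T ^ 2 ≤ D / T * T ^ 2 := by gcongr
          _ = D * T := by field_simp
    have b1 : T * D ≤ √(D * T) ^ 2 := by rw [hsq', mul_comm]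
    have b2 : D * (l / n) ≤ 4 * √(D * T) ^ 2 := by
      rw [hsq']
      have c1 := mul_le_mul_of_nonneg_left hL hD0.le
      have c2 : D * D ≤ D * T := by gcongr
      have c3 : D * δ ≤ D * T := by gcongr
      linarith
    have := (hmain _ (Real.sqrt_nonneg _) b0 b1 b2).2
    rw [mul_pow, hsq', ← mul_assoc, ← mul_assoc] at this
    have := le_of_mul_le_mul_right this hTpos
    -- The constant 4 · 10¹⁰ dominates 768 · 6681² as well as 24 · 6681.
    linarith

lemma globalRate_pos (hd : 1 ≤ d) (hdn : d ≤ n) : 0 < globalRate n d δ := by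
  have h1 : (0 : ℝ) < d := by positivity
  have h2 : (0 : ℝ) < n := by have : 0 < n := by omega
                              positivity
  have := Real.sqrt_nonneg (δ * d / n)
  unfold globalRate
  positivity

lemma localRate_pos (hd : 1 ≤ d) (hdn : d ≤ n) (h0 : 0 < δ) (θ : EuclideanSpace ℝ (Fin d)) :
    0 < localRate n δ θ := by
  have h1 : (0 : ℝ) < d := by positivity
  have h2 : (0 : ℝ) < n := by have : 0 < n := by omega
                              positivity
  unfold localRate
  split_ifs with h3 h4
  · exact globalRate_pos hd hdn
  · have : 0 < ‖θ‖ ^ 2 := by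
      have : 0 ≤ (d : ℝ) / n := by positivity
      exact this.trans_lt ((le_max_right _ _).trans_lt (not_le.1 h3))
    positivity
  · positivity

/-- In the middle branch ‖θ‖² exceeds s = √(δd/n), so s²/‖θ‖² ≤ s. Hence the local bound yields the
global one. -/
lemma localRate_le_globalRate (hd : 1 ≤ d) (hdn : d ≤ n) (h0 : 0 < δ)
    (θ : EuclideanSpace ℝ (Fin d)) : localRate n δ θ ≤ globalRate n d δ := by
  have h1 : (0 : ℝ) < d := by positivity
  have h2 : (0 : ℝ) < n := by have : 0 < n := by omega
                              positivity
  have hs := Real.sqrt_nonneg (δ * d / n)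
  have hD : 0 < (d : ℝ) / n := by positivity
  unfold localRate
  split_ifs with h3 h4
  · exact le_rfl
  · have h5 : √(δ * d / n) < ‖θ‖ ^ 2 := (le_max_left _ _).trans_lt (not_le.1 h3)
    have h6 : √(δ * d / n) ^ 2 = δ * d / n := Real.sq_sqrt (by positivity)
    rw [globalRate, div_le_iff₀ (hs.trans_lt h5)]
    refine h6.symm.trans_le ?_
    rw [sq]
    gcongr
    linarith
  · rw [globalRate]; linarith

lemma IsModel.exists_bad_event_localRate {Ω : Type*} [MeasurableSpace Ω] {μ : Measure Ω}
    [IsProbabilityMeasure μ] {η : Fin n → Ω → ℝ} {ξ : Fin n → Ω → EuclideanSpace ℝ (Fin d)}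
    (hM : IsModel μ δ η ξ) (hd : 1 ≤ d) (hdn : d ≤ n) (h0 : 0 < δ) (h1 : δ < 1 / 2)
    {vmax : Matrix (Fin d) (Fin d) ℝ → EuclideanSpace ℝ (Fin d)} (hv : IsTopEigenvectorMap vmax)
    (θ : EuclideanSpace ℝ (Fin d)) :
    ∃ bad : Set Ω, μ bad ≤ ENNReal.ofReal (8 * Real.exp (-d)) ∧ ∀ ω ∉ bad,
      loss (oracle μ δ η ξ vmax θ ω) θ ^ 2 ≤ 40000000000 * localRate n δ θ := by
  obtain ⟨bad, hbad, hgood⟩ := hM.exists_bad_event_rates hd hdn h0 h1 hv θ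
  refine ⟨bad, hbad, fun ω hω => ?_⟩
  obtain ⟨r1, r2, r3⟩ := hgood ω hω
  unfold localRate
  split_ifs with h3 h4
  · exact r1 h3
  · have h3' := not_le.1 h3
    refine r2 ?_ h3'.le h4
    -- If δ < d/n, the middle branch would require d/n < ‖θ‖² ≤ d/n.
    by_contra! hc
    rw [max_eq_right hc.le] at h4
    exact absurd ((le_max_right _ _).trans_lt h3') (not_lt.2 h4)
  · exact r3 (not_le.1 h4).le

end

end MarkovMixture

end

/-! ### Passage to probabilities and suprema -/

theorem proposition1 :
    ∃ C c₀ c₁ : ℝ, 0 < C ∧ 0 < c₀ ∧ 0 < c₁ ∧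
      ∀ (n d : ℕ), 1 ≤ d → d ≤ n → ∀ δ : ℝ, 0 < δ → δ < 1 / 2 →
      ∀ (Ω : Type*) [MeasurableSpace Ω] (μ : Measure Ω) [IsProbabilityMeasure μ]
        (η : Fin n → Ω → ℝ) (ξ : Fin n → Ω → EuclideanSpace ℝ (Fin d)),
      MarkovMixture.IsModel μ δ η ξ →
      ∀ vmax : Matrix (Fin d) (Fin d) ℝ → EuclideanSpace ℝ (Fin d),
      MarkovMixture.IsTopEigenvectorMap vmax →
      -- the three regimes
      (∀ θ : EuclideanSpace ℝ (Fin d),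
        (‖θ‖ ^ 2 ≤ max (Real.sqrt (δ * d / n)) ((d : ℝ) / n) →
          μ {ω | ¬ MarkovMixture.loss (MarkovMixture.oracle μ δ η ξ vmax θ ω) θ ^ 2
                ≤ C * (Real.sqrt (δ * d / n) + (d : ℝ) / n)}
            ≤ ENNReal.ofReal (c₁ * Real.exp (-(c₀ * d)))) ∧
        ((d : ℝ) / n ≤ δ →
          max (Real.sqrt (δ * d / n)) ((d : ℝ) / n) ≤ ‖θ‖ ^ 2 →
          ‖θ‖ ^ 2 ≤ max δ ((d : ℝ) / n) →
          μ {ω | ¬ MarkovMixture.loss (MarkovMixture.oracle μ δ η ξ vmax θ ω) θ ^ 2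
                ≤ C * ((δ * d / n) / ‖θ‖ ^ 2)}
            ≤ ENNReal.ofReal (c₁ * Real.exp (-(c₀ * d)))) ∧
        (max δ ((d : ℝ) / n) ≤ ‖θ‖ ^ 2 →
          μ {ω | ¬ MarkovMixture.loss (MarkovMixture.oracle μ δ η ξ vmax θ ω) θ ^ 2
                ≤ C * ((d : ℝ) / n)}
            ≤ ENNReal.ofReal (c₁ * Real.exp (-(c₀ * d)))) ∧
        -- the global bound
        μ {ω | ¬ MarkovMixture.loss (MarkovMixture.oracle μ δ η ξ vmax θ ω) θ ^ 2
              ≤ C * (Real.sqrt (δ * d / n) + (d : ℝ) / n)}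
          ≤ ENNReal.ofReal (c₁ * Real.exp (-(c₀ * d)))) ∧
      -- local and global minimax optimality
      MarkovMixture.IsLocallyMinimaxOptimal μ n δ
        (MarkovMixture.oracle μ δ η ξ vmax) C c₀ c₁ ∧
      MarkovMixture.IsGloballyMinimaxOptimal μ n δ
        (MarkovMixture.oracle μ δ η ξ vmax) C c₀ c₁ := by
  open MarkovMixture in
  -- C exceeds 4 · 10¹⁰ strictly: the minimax events use a non-strict inequality, so excluding them
  -- needs this slack together with positive rates.
  refine ⟨100000000000, 1, 8, by norm_num, by norm_num, by norm_num, ?_⟩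
  intro n d hd hdn δ h0 h1 Ω _ μ _ η ξ hM vmax hv
  have hglob : 0 < globalRate n d δ := globalRate_pos hd hdn
  have hloc := fun θ => hM.exists_bad_event_localRate hd hdn h0 h1 hv θ
  have hle : ∀ θ, localRate n δ θ ≤ globalRate n d δ := fun θ =>
    localRate_le_globalRate (d := d) hd hdn h0 θ
  have hD : 0 < (d : ℝ) / n := by
    have : 0 < n := by omega
    positivity
  rw [one_mul]
  refine ⟨fun θ => ?_, iSup_le fun θ => ?_, iSup_le fun θ => ?_⟩
  · obtain ⟨bad, hbad, hgood⟩ := hM.exists_bad_event_rates hd hdn h0 h1 hv θ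
    refine ⟨fun hr => ?_, fun hr1 hr2 hr3 => ?_, fun hr => ?_, ?_⟩
    · refine (measure_mono fun ω hω => ?_).trans hbad
      by_contra hc
      refine hω (((hgood ω hc).1 hr).trans ?_)
      have := hglob
      rw [globalRate] at this
      linarith
    · refine (measure_mono fun ω hω => ?_).trans hbad
      by_contra hc
      refine hω (((hgood ω hc).2.1 hr1 hr2 hr3).trans ?_)
      have : 0 ≤ δ * d / n / ‖θ‖ ^ 2 := by positivity
      linarith
    · refine (measure_mono fun ω hω => ?_).trans hbad
      by_contra hc
      refine hω (((hgood ω hc).2.2 hr).trans ?_)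
      linarith
    · obtain ⟨bad, hbad, hgood⟩ := hloc θ
      refine (measure_mono fun ω hω => ?_).trans hbad
      by_contra hc
      refine hω ((hgood ω hc).trans ?_)
      have := hle θ
      rw [globalRate] at this hglob
      linarith
  · rw [one_mul]
    obtain ⟨bad, hbad, hgood⟩ := hloc θ
    refine (measure_mono fun ω hω => ?_).trans hbad
    by_contra hc
    rw [Set.mem_ofPred_eq] at hω
    have := hgood ω hc
    have := localRate_pos (d := d) hd hdn h0 θ
    linarith
  · rw [one_mul]
    obtain ⟨bad, hbad, hgood⟩ := hloc θ
    refine (measure_mono fun ω hω => ?_).trans hbad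
    by_contra hc
    rw [Set.mem_ofPred_eq] at hω
    have := hgood ω hc
    have := hle θ
    linarith
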